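/- **Setting.** Let $f_0,f_1$ be probability densities with respect to a $\sigma$-finite measure $\nu$, whose Kullback–Leibler divergences $I_0=\int\log(f_0/f_1)\,f_0\,d\nu$ and $I_1=\int\log(f_1/f_0)\,f_1\,d\nu$ are positive and finite. For $i\in\{0,1\}$ let $\mathsf P_i$ (with expectation $\mathsf E_i$) be the law of an iid sequence $X=(X_n)_{n\ge1}$ with density $f_i$, and for $\pi\in[0,1]$ let $\mathsf P_\pi=(1-\pi)\mathsf P_0+\pi\mathsf P_1$, with expectation $\mathsf E_\pi$. A *test* is a pair $(T,D)$, where $T$ is a stopping time with values in $\{1,2,\dots\}\cup\{\infty\}$ with respect to $\mathcal F_n=\sigma(X_1,\dots,X_n)$ and $D$ is a $\{0,1\}$-valued random variable with $\{T=n,D=i\}\in\mathcal F_n$ for all $n\geq 1$, $i\in\{0,1\}$. For $\alpha,\beta\in(0,1)$ let $\mathcal E(\alpha,\beta)$ be the class of tests with $\mathsf P_0(D=1)\le\alpha$ and $\mathsf P_1(D=0)\le\beta$, and let $\mathcal L_\pi(\alpha,\beta)=\inf_{(T,D)\in\mathcal E(\alpha,\beta)}\mathsf E_\pi[T]$ for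 $\pi\in[0,1]$. For each integer $m\ge1$ let $l_m,u_m$ be integers with $0\le l_m\le u_m\le m$, $u_m>0$, $l_m<m$, and for $\alpha,\beta\in(0,1)$ put $$\alpha_m=1-(1-\alpha)^{1/(m-l_m)},\qquad \beta_m=1-(1-\beta)^{1/u_m}.$$ Let $\chi^*=\{(T^*(\alpha,\beta),D^*(\alpha,\beta))\in\mathcal E(\alpha,\beta):\alpha,\beta\in(0,1)\}$ be a family of tests. It is called *asymptotically optimal in the high-dimensional sense* if, for all $\alpha,\beta\in(0,1)$, $$\max_{l_m\le s\le u_m}\frac{\mathsf E_{s/m}[T^*(\alpha_m,\beta_m)]}{\mathcal L_{s/m}(\alpha_m,\beta_m)}\longrightarrow1\qquad (m\to\infty).$$ Below, $x_m\sim y_m$ means $x_m/y_m\to1$ and $x_m\ll y_m$ means $x_m/y_m\to0$ as $m\to\infty$. **Theorem.** Suppose that $u_m\to\infty$ and $m-l_m\to\infty$ as $m\to\infty$. (i) For all $\alpha,\beta\in(0,1)$, $$\mathcal L_{s/m}(\alpha_m,\beta_m)\sim\Big(1-\frac sm\Big)\frac{\log u_m}{I_0}+\frac sm\,\frac{\log(m-l_m)}{I_1}\quad\text{uniformly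 in } s\in\{l_m,\dots,u_m\},$$ i.e. the maximum over $s\in\{l_m,\dots,u_m\}$ of the distance from $1$ of the ratio of the two sides tends to $0$ as $m\to\infty$. (ii) If, for all $\alpha,\beta\in(0,1)$, $\mathsf E_0[T^*(\alpha_m,\beta_m)]\sim\mathcal L_0(\alpha_m,\beta_m)$ and $\mathsf E_1[T^*(\alpha_m,\beta_m)]\sim\mathcal L_1(\alpha_m,\beta_m)$, then $\chi^*$ is asymptotically optimal in the high-dimensional sense. (iii) If, for all $\alpha,\beta\in(0,1)$, $\mathsf E_0[T^*(\alpha_m,\beta_m)]\sim\mathcal L_0(\alpha_m,\beta_m)$ and $$\mathsf E_1[T^*(\alpha_m,\beta_m)]\ll\frac{(m-u_m)\log u_m}{u_m},$$ then $\chi^*$ is asymptotically optimal in the high-dimensional sense. -/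

import Mathlib

open MeasureTheory Filter Topology InformationTheory
open scoped ENNReal

namespace SignalRecovery

/-- The σ-algebra `σ(X₁, …, Xₙ)` generated by the first `n` observations, on the canonical space
of sequences of observations; the observation `Xₖ` is the coordinate `ω (k - 1)`. -/
abbrev obsSigma (E : Type*) [MeasurableSpace E] (n : ℕ) : MeasurableSpace (ℕ → E) :=
  MeasurableSpace.comap (fun (ω : ℕ → E) (i : Fin n) => ω i) MeasurableSpace.pi

/-- A sequential test: a stopping time `T`, valued in the positive integers and `∞`, and a binary
decision `D` (the null hypothesis is rejected iff `D = 1`) which is `ℱ_T`-measurable. -/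
structure SeqTest (E : Type*) [MeasurableSpace E] where
  T : (ℕ → E) → ℕ∞
  D : (ℕ → E) → Fin 2
  one_le_T : ∀ ω, 1 ≤ T ω
  measurableSet_T : ∀ n : ℕ, MeasurableSet[obsSigma E n] {ω | T ω = n}
  measurable_D : Measurable D
  measurableSet_T_D : ∀ (n : ℕ) (i : Fin 2), MeasurableSet[obsSigma E n] {ω | T ω = n ∧ D ω = i}

/-- The distribution of an iid sequence of observations with common law `μ`. -/
noncomputable def pathLaw {E : Type*} [MeasurableSpace E] (μ : Measure E)
    [IsProbabilityMeasure μ] : Measure (ℕ → E) :=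
  Measure.infinitePi (fun _ : ℕ => μ)

/-- The mixture `P_π = (1 - π) P₀ + π P₁`, for `π ∈ [0, 1]`, where `Pᵢ` is the distribution of the
sequence of observations when their common law is `μᵢ`. -/
noncomputable def mixLaw {E : Type*} [MeasurableSpace E] (μ₀ μ₁ : Measure E)
    [IsProbabilityMeasure μ₀] [IsProbabilityMeasure μ₁] (π : ℝ) : Measure (ℕ → E) :=
  ENNReal.ofReal (1 - π) • pathLaw μ₀ + ENNReal.ofReal π • pathLaw μ₁

/-- The expected sample size of a test when the sequence of observations has distribution `P`. -/
noncomputable def expSampleSize {E : Type*} [MeasurableSpace E] (P : Measure (ℕ → E))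
    (τ : SeqTest E) : ℝ≥0∞ :=
  ∫⁻ ω, (τ.T ω : ℝ≥0∞) ∂P

/-- The class `ℰ(α, β)` of tests of `H₀ : μ₀` against `H₁ : μ₁` whose type-I and type-II error
probabilities do not exceed `α` and `β`. -/
def testClass {E : Type*} [MeasurableSpace E] (μ₀ μ₁ : Measure E)
    [IsProbabilityMeasure μ₀] [IsProbabilityMeasure μ₁] (α β : ℝ) : Set (SeqTest E) :=
  {τ | pathLaw μ₀ {ω | τ.D ω = 1} ≤ ENNReal.ofReal α ∧
       pathLaw μ₁ {ω | τ.D ω = 0} ≤ ENNReal.ofReal β}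

/-- The optimal expected sample size in `ℰ(α, β)` when the sequence of observations has
distribution `P`. It is `ℒᵢ(α, β)` for `P = pathLaw μᵢ` and `ℒ_π(α, β)` for
`P = mixLaw μ₀ μ₁ π`. -/
noncomputable def optSampleSize {E : Type*} [MeasurableSpace E] (μ₀ μ₁ : Measure E)
    [IsProbabilityMeasure μ₀] [IsProbabilityMeasure μ₁] (P : Measure (ℕ → E)) (α β : ℝ) : ℝ≥0∞ :=
  ⨅ τ ∈ testClass μ₀ μ₁ α β, expSampleSize P τ

/-- A family of tests `χ α β ∈ ℰ(α, β)`, for `α, β ∈ (0, 1)`. -/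
def IsTestFamily {E : Type*} [MeasurableSpace E] (μ₀ μ₁ : Measure E)
    [IsProbabilityMeasure μ₀] [IsProbabilityMeasure μ₁] (χ : ℝ → ℝ → SeqTest E) : Prop :=
  ∀ α ∈ Set.Ioo (0 : ℝ) 1, ∀ β ∈ Set.Ioo (0 : ℝ) 1, χ α β ∈ testClass μ₀ μ₁ α β

/-- `α_m = 1 - (1 - α)^{1/(m - l_m)}`. -/
noncomputable def alphaM (l : ℕ → ℕ) (α : ℝ) (m : ℕ) : ℝ :=
  1 - (1 - α) ^ (1 / ((m : ℝ) - (l m : ℝ)))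

/-- `β_m = 1 - (1 - β)^{1/u_m}`. -/
noncomputable def betaM (u : ℕ → ℕ) (β : ℝ) (m : ℕ) : ℝ :=
  1 - (1 - β) ^ (1 / (u m : ℝ))

/-- Asymptotic optimality in the high-dimensional sense: for all `α, β ∈ (0, 1)`,
`max_{l_m ≤ s ≤ u_m} E_{s/m}[T*(α_m, β_m)] / ℒ_{s/m}(α_m, β_m) → 1` as `m → ∞`. -/
def HighDimOptimal {E : Type*} [MeasurableSpace E] (μ₀ μ₁ : Measure E)
    [IsProbabilityMeasure μ₀] [IsProbabilityMeasure μ₁] (l u : ℕ → ℕ)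
    (χ : ℝ → ℝ → SeqTest E) : Prop :=
  ∀ α ∈ Set.Ioo (0 : ℝ) 1, ∀ β ∈ Set.Ioo (0 : ℝ) 1,
    Tendsto (fun m : ℕ => ⨆ s ∈ Finset.Icc (l m) (u m),
      expSampleSize (mixLaw μ₀ μ₁ ((s : ℝ) / m)) (χ (alphaM l α m) (betaM u β m)) /
        optSampleSize μ₀ μ₁ (mixLaw μ₀ μ₁ ((s : ℝ) / m)) (alphaM l α m) (betaM u β m))
      atTop (𝓝 1)

/-- `Eᵢ[T*(α_m, β_m)] ∼ ℒᵢ(α_m, β_m)` as `m → ∞`, for all `α, β ∈ (0, 1)`; here `P = Pᵢ`. -/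
def OptimalAlong {E : Type*} [MeasurableSpace E] (μ₀ μ₁ : Measure E)
    [IsProbabilityMeasure μ₀] [IsProbabilityMeasure μ₁] (P : Measure (ℕ → E)) (l u : ℕ → ℕ)
    (χ : ℝ → ℝ → SeqTest E) : Prop :=
  ∀ α ∈ Set.Ioo (0 : ℝ) 1, ∀ β ∈ Set.Ioo (0 : ℝ) 1,
    Tendsto (fun m : ℕ => expSampleSize P (χ (alphaM l α m) (betaM u β m)) /
      optSampleSize μ₀ μ₁ P (alphaM l α m) (betaM u β m)) atTop (𝓝 1)

end SignalRecovery

open SignalRecovery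

/-! The expected sample size is affine in the law, so `E_π[T] = (1 - π) E₀[T] + π E₁[T]`, and only
`P₀` and `P₁` have to be studied. Put `p = log u_m / I₀` and `q = log (m - l_m) / I₁`. Every test of
the class satisfies `E₀[T] ≥ (1 - δ) p` and `E₁[T] ≥ (1 - δ) q` for large `m`, and a single test,
Wald's SPRT, satisfies both reverse bounds with `1 + δ` (`eventually_sizeBounds`). The optimum under
`P_π` is therefore within a factor `1 ± δ` of `(1 - π) p + π q`, uniformly in `π`, which is (i).

Lower bound (`ofReal_le_expSampleSize`): change of measure at `T ∧ N`, Jensen's inequality and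
Wald's identity bound `E₀[T]` below by about `-log β / I₀`. Upper bound (`exists_mem_testClass`):
Wald's identity for steps capped at `M`, so that the overshoot is at most `M`; the mean of the
capped step tends to the divergence as `M` grows. Finally `-log α_m ∼ log (m - l_m)` and `-log β_m ∼
log u_m`.

For (ii), the two endpoint estimates are averaged. For (iii), `s ≤ u_m` gives `(s/m) (m - u_m) / u_m
≤ 1 - s/m`, so the contribution of `P₁` is negligible against `(1 - s/m) p`. -/

namespace SignalRecovery

section

variable {E : Type*} [MeasurableSpace E]

/-! ### Path laws, change of measure and Wald's identity -/

instance (μ : Measure E) [IsProbabilityMeasure μ] : IsProbabilityMeasure (pathLaw μ) := by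
  unfold pathLaw; infer_instance

theorem obsSigma_le (n : ℕ) : obsSigma E n ≤ MeasurableSpace.pi := by
  have h : Measurable (fun (ω : ℕ → E) (i : Fin n) => ω i) := by fun_prop
  exact h.comap_le

theorem obsSigma_mono {m n : ℕ} (h : m ≤ n) : obsSigma E m ≤ obsSigma E n := by
  rw [obsSigma, ← measurable_iff_comap_le]
  refine @measurable_pi_lambda _ _ _ (obsSigma E n) _ _ fun i => ?_
  exact (measurable_pi_apply (Fin.castLE h i)).comp
    (comap_measurable (fun (ω : ℕ → E) (i : Fin n) => ω i))

theorem measurable_coord_obsSigma {i n : ℕ} (h : i < n) :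
    Measurable[obsSigma E n] (fun ω : ℕ → E => ω i) :=
  (measurable_pi_apply (⟨i, h⟩ : Fin n)).comp
    (comap_measurable (fun (ω : ℕ → E) (i : Fin n) => ω i))

/-- The random walk with steps `Y (X₁), Y (X₂), …`. -/
def walk (Y : E → ℝ) (n : ℕ) (ω : ℕ → E) : ℝ := ∑ i ∈ Finset.range n, Y (ω i)

theorem measurable_walk_obsSigma {Y : E → ℝ} (hY : Measurable Y) {k n : ℕ} (hk : k ≤ n) :
    Measurable[obsSigma E n] (walk Y k) := by
  refine @Finset.measurable_sum _ _ _ _ _ _ (obsSigma E n) _ _ fun i hi => ?_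
  exact hY.comp (measurable_coord_obsSigma ((Finset.mem_range.1 hi).trans_le hk))

theorem measurable_walk {Y : E → ℝ} (hY : Measurable Y) (n : ℕ) : Measurable (walk Y n) :=
  (measurable_walk_obsSigma hY le_rfl).mono (obsSigma_le n) le_rfl

theorem walk_neg {E : Type*} (Y : E → ℝ) (n : ℕ) (ω : ℕ → E) :
    walk (fun x => -Y x) n ω = -walk Y n ω := by
  simp [walk]

/-- The law of the first `n` observations. -/
theorem map_pathLaw (μ : Measure E) [IsProbabilityMeasure μ] (n : ℕ) :
    (pathLaw μ).map (fun (ω : ℕ → E) (i : Fin n) => ω i) = Measure.pi fun _ => μ := by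
  rw [← Measure.infinitePi_eq_pi, pathLaw]
  exact Measure.map_infinitePi_infinitePi_of_inj (P := fun _ : ℕ => μ)
    (f := fun i : Fin n => (i : ℕ)) Fin.val_injective

theorem lintegral_prod_coord (μ : Measure E) [IsProbabilityMeasure μ] (n : ℕ)
    {g : ℕ → E → ℝ≥0∞} (hg : ∀ i, Measurable (g i)) :
    ∫⁻ ω, ∏ i ∈ Finset.range n, g i (ω i) ∂pathLaw μ =
      ∏ i ∈ Finset.range n, ∫⁻ x, g i x ∂μ := by
  have h := ProbabilityTheory.iIndepFun_infinitePi (P := fun _ : ℕ => μ) hg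
  have h2 := ProbabilityTheory.lintegral_prod_eq_prod_lintegral_of_indepFun
    (Finset.range n) _ h (fun i => (hg i).comp (measurable_pi_apply i))
  refine h2.trans (Finset.prod_congr rfl fun i _ => ?_)
  exact (measurePreserving_eval_infinitePi (fun _ : ℕ => μ) i).lintegral_comp (hg i)

/-- Change of measure on `σ(X₁, …, Xₙ)`. -/
theorem pathLaw_eq_setLIntegral_exp_walk {μ μ' : Measure E} [IsProbabilityMeasure μ]
    [IsProbabilityMeasure μ'] {Y : E → ℝ} (hY : Measurable Y)
    (h : μ' = μ.withDensity fun x => ENNReal.ofReal (Real.exp (Y x))) {n : ℕ}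
    {A : Set (ℕ → E)} (hA : MeasurableSet[obsSigma E n] A) :
    pathLaw μ' A = ∫⁻ ω in A, ENNReal.ofReal (Real.exp (walk Y n ω)) ∂pathLaw μ := by
  have hρ : Measurable (fun (ω : ℕ → E) (i : Fin n) => ω i) := by fun_prop
  have hexp : Measurable fun x => ENNReal.ofReal (Real.exp (Y x)) := by fun_prop
  have key : (Measure.pi fun _ : Fin n => μ') = ((pathLaw μ).withDensity
      fun ω => ENNReal.ofReal (Real.exp (walk Y n ω))).map
        (fun (ω : ℕ → E) (i : Fin n) => ω i) := by
    refine Measure.pi_eq fun s hs => ?_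
    rw [Measure.map_apply hρ (.univ_pi hs), withDensity_apply _ (hρ (.univ_pi hs)),
      ← lintegral_indicator (hρ (.univ_pi hs))]
    -- Padding with `univ` turns the product over `Fin n` into one over `range n`.
    let t : ℕ → Set E := fun i => if h : i < n then s ⟨i, h⟩ else Set.univ
    have ht : ∀ i, MeasurableSet (t i) := fun i => by
      by_cases hi : i < n <;> simp [t, hi, hs]
    have := lintegral_prod_coord μ n
      (g := fun i => (t i).indicator fun x => ENNReal.ofReal (Real.exp (Y x)))
      (fun i => hexp.indicator (ht i))
    calc _ = _ := ?_
      _ = _ := this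
      _ = _ := ?_
    · refine lintegral_congr fun ω => ?_
      by_cases hω : ∀ i : Fin n, ω i ∈ s i
      · rw [Set.indicator_of_mem (by simpa using hω), walk, Real.exp_sum,
          ENNReal.ofReal_prod_of_nonneg fun _ _ => (Real.exp_pos _).le]
        refine Finset.prod_congr rfl fun i hi => ?_
        rw [Finset.mem_range] at hi
        rw [Set.indicator_of_mem]
        simpa [t, hi] using hω ⟨i, hi⟩
      · rw [Set.indicator_of_notMem (by simpa using hω)]
        push Not at hω
        obtain ⟨i, hi⟩ := hω
        refine (Finset.prod_eq_zero (Finset.mem_range.2 i.2) ?_).symm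
        rw [Set.indicator_of_notMem]
        simpa [t] using hi
    · rw [Finset.prod_range]
      refine Finset.prod_congr rfl fun i _ => ?_
      simp [t, lintegral_indicator (hs i), h, withDensity_apply _ (hs i)]
  obtain ⟨B, hB, rfl⟩ := hA
  rw [← Measure.map_apply hρ hB, map_pathLaw, key, Measure.map_apply hρ hB,
    withDensity_apply _ (hρ hB)]

/-- The set `{T > k}` is determined by the first `k` observations. -/
theorem SeqTest.measurableSet_lt_T (τ : SeqTest E) (k : ℕ) :
    MeasurableSet[obsSigma E k] {ω | (k : ℕ∞) < τ.T ω} := by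
  have : {ω | (k : ℕ∞) < τ.T ω} = ⋂ j ∈ Finset.range (k + 1), {ω | τ.T ω = (j : ℕ)}ᶜ := by
    ext ω
    simp only [Set.mem_ofPred_eq, Set.mem_iInter, Set.mem_compl_iff, Finset.mem_range]
    constructor
    · intro h j hj he
      rw [he] at h
      have : k < j := by exact_mod_cast h
      omega
    · intro h
      by_contra! hle
      obtain ⟨j, hj⟩ := ENat.ne_top_iff_exists.1 (ne_top_of_le_ne_top (ENat.natCast_ne_top k) hle)
      rw [← hj] at hle
      have : j ≤ k := by exact_mod_cast hle
      exact h j (by omega) hj.symm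
  rw [this]
  refine Finset.measurableSet_biInter _ fun j hj => ?_
  exact (obsSigma_mono (by simpa [Nat.lt_succ_iff] using hj) _ (τ.measurableSet_T j)).compl

theorem SeqTest.measurableSet_lt_T' (τ : SeqTest E) (k : ℕ) :
    MeasurableSet {ω | (k : ℕ∞) < τ.T ω} :=
  obsSigma_le k _ (τ.measurableSet_lt_T k)

theorem coe_enat_eq_tsum (x : ℕ∞) :
    (x : ℝ≥0∞) = ∑' i : ℕ, if (i : ℕ∞) < x then 1 else 0 := by
  induction x using ENat.recTopCoe with
  | top => simp
  | coe n =>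
    rw [tsum_eq_sum (s := Finset.range n)]
    · rw [Finset.sum_congr rfl fun i hi => if_pos (by exact_mod_cast Finset.mem_range.1 hi)]
      simp
    · simp +contextual

theorem expSampleSize_eq_tsum (P : Measure (ℕ → E)) (τ : SeqTest E) :
    expSampleSize P τ = ∑' i : ℕ, P {ω | (i : ℕ∞) < τ.T ω} := by
  simp only [expSampleSize, coe_enat_eq_tsum]
  rw [lintegral_tsum]
  · refine tsum_congr fun i => ?_
    rw [← lintegral_indicator_one (τ.measurableSet_lt_T' i)]
    simp [Set.indicator_apply]
  · intro i
    exact (Measurable.ite (τ.measurableSet_lt_T' i) measurable_const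
      measurable_const).aemeasurable

/-- The random walk stopped at `T ∧ N`. -/
noncomputable def stoppedWalk (Y : E → ℝ) (τ : SeqTest E) (N : ℕ) (ω : ℕ → E) : ℝ :=
  ∑ i ∈ Finset.range N, if (i : ℕ∞) < τ.T ω then Y (ω i) else 0

theorem stoppedWalk_of_eq {Y : E → ℝ} {τ : SeqTest E} {N k : ℕ} {ω : ℕ → E}
    (h : τ.T ω = k) (hk : k ≤ N) : stoppedWalk Y τ N ω = walk Y k ω := by
  rw [stoppedWalk, walk, ← Finset.sum_filter, h]
  refine Finset.sum_congr ?_ fun _ _ => rfl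
  ext i
  simp
  omega

theorem stoppedWalk_of_lt {Y : E → ℝ} {τ : SeqTest E} {N : ℕ} {ω : ℕ → E}
    (h : (N : ℕ∞) < τ.T ω) : stoppedWalk Y τ N ω = walk Y N ω := by
  refine Finset.sum_congr rfl fun i hi => if_pos (lt_trans ?_ h)
  exact_mod_cast Finset.mem_range.1 hi

theorem measurable_stoppedWalk {Y : E → ℝ} (hY : Measurable Y) (τ : SeqTest E) (N : ℕ) :
    Measurable (stoppedWalk Y τ N) :=
  Finset.measurable_sum _ fun i _ => Measurable.ite (τ.measurableSet_lt_T' i)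
    (hY.comp (measurable_pi_apply i)) measurable_const

theorem indepFun_coord (μ : Measure E) [IsProbabilityMeasure μ] (n : ℕ) :
    ProbabilityTheory.IndepFun (fun (ω : ℕ → E) (i : Fin n) => ω i) (fun ω => ω n)
      (pathLaw μ) := by
  have h := (ProbabilityTheory.iIndepFun_infinitePi (P := fun _ : ℕ => μ)
    (X := fun _ => id) (fun _ => measurable_id)).indepFun_finset (Finset.range n) {n}
    (by simp) (fun i => measurable_pi_apply i)
  exact h.comp (φ := fun (x : Finset.range n → E) (i : Fin n) => x ⟨i, by simp⟩)
    (ψ := fun x : ({n} : Finset ℕ) → E => x ⟨n, by simp⟩) (by fun_prop) (by fun_prop)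

/-- Wald's identity for the time `T ∧ N`. -/
theorem integral_stoppedWalk (μ : Measure E) [IsProbabilityMeasure μ] {Y : E → ℝ}
    (hY : Measurable Y) (hYi : Integrable Y μ) (τ : SeqTest E) (N : ℕ) :
    Integrable (stoppedWalk Y τ N) (pathLaw μ) ∧
    ∫ ω, stoppedWalk Y τ N ω ∂pathLaw μ =
      (∫ x, Y x ∂μ) * ∑ i ∈ Finset.range N, (pathLaw μ).real {ω | (i : ℕ∞) < τ.T ω} := by
  have hmp := fun i => measurePreserving_eval_infinitePi (fun _ : ℕ => μ) i
  have hi : ∀ i : ℕ, Integrable (fun ω : ℕ → E => Y (ω i)) (pathLaw μ) := fun i =>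
    (hmp i).integrable_comp_of_integrable hYi
  have hint : ∀ i : ℕ, Integrable (fun ω : ℕ → E => if (i : ℕ∞) < τ.T ω then Y (ω i) else 0)
      (pathLaw μ) := fun i => by
    refine ((hi i).indicator (τ.measurableSet_lt_T' i)).congr (ae_of_all _ fun ω => ?_)
    simp [Set.indicator_apply]
  refine ⟨integrable_finsetSum _ fun i _ => hint i, ?_⟩
  unfold stoppedWalk
  rw [integral_finsetSum _ fun i _ => hint i, Finset.mul_sum]
  refine Finset.sum_congr rfl fun i _ => ?_
  -- `{T > i}` depends only on coordinates `0, …, i - 1`, hence is independent of the step `Y (ω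
  -- i)`.
  obtain ⟨B, hB, hBe⟩ := τ.measurableSet_lt_T i
  have hφ : Measurable (B.indicator fun _ => (1 : ℝ)) := measurable_const.indicator hB
  have hind := (indepFun_coord μ i).comp hφ hY
  have h := hind.integral_fun_mul_eq_mul_integral
    (hφ.comp (by fun_prop)).aestronglyMeasurable
    (hY.comp (measurable_pi_apply i)).aestronglyMeasurable
  have e1 : ∀ ω : ℕ → E, ((B.indicator fun _ => (1 : ℝ)) ∘ fun (ω : ℕ → E) (i : Fin i) => ω i) ω =
      {ω | (i : ℕ∞) < τ.T ω}.indicator (fun _ => 1) ω := fun ω => by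
    rw [← hBe]; rfl
  simp only [e1] at h
  rw [integral_indicator_const _ (τ.measurableSet_lt_T' i)] at h
  have e2 : ∫ ω, (Y ∘ fun ω : ℕ → E => ω i) ω ∂pathLaw μ = ∫ x, Y x ∂μ := by
    have := integral_map (hmp i).measurable.aemeasurable
      (hY.aestronglyMeasurable (μ := (Measure.infinitePi fun _ : ℕ => μ).map (Function.eval i)))
    rw [(hmp i).map_eq] at this
    exact this.symm
  rw [e2] at h
  rw [mul_comm]
  refine Eq.trans ?_ (h.trans (by simp))
  refine integral_congr_ae (ae_of_all _ fun ω => ?_)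
  by_cases hω : (i : ℕ∞) < τ.T ω <;> simp [hω]

/-- Change of measure at the time `T ∧ N`. -/
theorem pathLaw_eq_setLIntegral_exp_stoppedWalk {μ μ' : Measure E} [IsProbabilityMeasure μ]
    [IsProbabilityMeasure μ'] {Y : E → ℝ} (hY : Measurable Y)
    (h : μ' = μ.withDensity fun x => ENNReal.ofReal (Real.exp (Y x))) (τ : SeqTest E) {N : ℕ}
    {A : Set (ℕ → E)} (hA : ∀ k ≤ N, MeasurableSet[obsSigma E k] (A ∩ {ω | τ.T ω = k}))
    (hAN : MeasurableSet[obsSigma E N] (A ∩ {ω | (N : ℕ∞) < τ.T ω})) :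
    pathLaw μ' A = ∫⁻ ω in A, ENNReal.ofReal (Real.exp (stoppedWalk Y τ N ω)) ∂pathLaw μ := by
  -- Partition of `A` by the value of `T`; the index `N + 1` holds the paths still running after
  -- time `N`.
  let S : ℕ → Set (ℕ → E) := fun k =>
    if k ≤ N then A ∩ {ω | τ.T ω = k} else
      if k = N + 1 then A ∩ {ω | (N : ℕ∞) < τ.T ω} else ∅
  have hSA : A = ⋃ k, S k := by
    ext ω
    simp only [Set.mem_iUnion]
    constructor
    · intro hω
      by_cases hN : (N : ℕ∞) < τ.T ω
      · exact ⟨N + 1, by simp [S, hω, hN]⟩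
      · rw [not_lt] at hN
        obtain ⟨j, hj⟩ := ENat.ne_top_iff_exists.1 (ne_top_of_le_ne_top (ENat.natCast_ne_top N) hN)
        rw [← hj] at hN
        have : j ≤ N := by exact_mod_cast hN
        exact ⟨j, by simp [S, this, hω, ← hj]⟩
    · rintro ⟨k, hk⟩
      simp only [S] at hk
      split_ifs at hk
      exacts [hk.1, hk.1, hk.elim]
  have hm : ∀ k, MeasurableSet (S k) := by
    intro k
    simp only [S]
    split_ifs with h1 h2
    exacts [obsSigma_le _ _ (hA k h1), obsSigma_le _ _ hAN, .empty]
  have hd : Pairwise (Function.onFun Disjoint S) := by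
    intro i j hij
    refine Set.disjoint_left.2 fun ω hi hj => ?_
    simp only [S] at hi hj
    split_ifs at hi hj with h1 h2 h3 h4 h5 h6
    · have := hi.2.symm.trans hj.2
      exact hij (by exact_mod_cast this)
    · have h7 : τ.T ω = i := hi.2
      have h8 : (N : ℕ∞) < τ.T ω := hj.2
      rw [h7] at h8
      have : N < i := by exact_mod_cast h8
      omega
    · exact hj
    · have h7 : τ.T ω = j := hj.2
      have h8 : (N : ℕ∞) < τ.T ω := hi.2
      rw [h7] at h8
      have : N < j := by exact_mod_cast h8
      omega
    · omega
    · exact hj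
    all_goals exact hi
  conv_lhs => rw [hSA]
  conv_rhs => rw [hSA]
  rw [measure_iUnion hd hm, lintegral_iUnion hm hd]
  refine tsum_congr fun k => ?_
  simp only [S]
  split_ifs with h1 h2
  · rw [pathLaw_eq_setLIntegral_exp_walk hY h (hA k h1)]
    refine setLIntegral_congr_fun (obsSigma_le _ _ (hA k h1)) fun ω hω => ?_
    simp only [stoppedWalk_of_eq hω.2 h1]
  · rw [pathLaw_eq_setLIntegral_exp_walk hY h hAN]
    refine setLIntegral_congr_fun (obsSigma_le _ _ hAN) fun ω hω => ?_
    simp only [stoppedWalk_of_lt hω.2]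
  · simp

/-- The event that the test has stopped by time `N` with decision `i`. -/
def SeqTest.decidedBy (τ : SeqTest E) (i : Fin 2) (N : ℕ) : Set (ℕ → E) :=
  {ω | τ.T ω ≤ N ∧ τ.D ω = i}

theorem SeqTest.measurableSet_D (τ : SeqTest E) (i : Fin 2) : MeasurableSet {ω | τ.D ω = i} :=
  τ.measurable_D (measurableSet_singleton i)

theorem SeqTest.measurableSet_decidedBy (τ : SeqTest E) (i : Fin 2) (N : ℕ) :
    MeasurableSet (τ.decidedBy i N) := by
  have : τ.decidedBy i N = {ω | (N : ℕ∞) < τ.T ω}ᶜ ∩ {ω | τ.D ω = i} := by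
    ext ω
    simp [SeqTest.decidedBy]
  rw [this]
  exact (τ.measurableSet_lt_T' N).compl.inter (τ.measurableSet_D i)

theorem SeqTest.decidedBy_inter_eq (τ : SeqTest E) (i : Fin 2) {k N : ℕ} (hk : k ≤ N) :
    τ.decidedBy i N ∩ {ω | τ.T ω = k} = {ω | τ.T ω = k ∧ τ.D ω = i} := by
  ext ω
  simp only [SeqTest.decidedBy, Set.mem_inter_iff, Set.mem_ofPred_eq]
  constructor
  · rintro ⟨⟨_, h1⟩, h2⟩
    exact ⟨h2, h1⟩
  · rintro ⟨h1, h2⟩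
    exact ⟨⟨by rw [h1]; exact_mod_cast hk, h2⟩, h1⟩

theorem SeqTest.decidedBy_inter_lt (τ : SeqTest E) (i : Fin 2) (N : ℕ) :
    τ.decidedBy i N ∩ {ω | (N : ℕ∞) < τ.T ω} = ∅ := by
  ext ω
  simp +contextual [SeqTest.decidedBy]

/-! ### Lower bound on the sample size and SPRT error bounds -/

section ChangeOfMeasure

variable {μ μ' : Measure E} [IsProbabilityMeasure μ] [IsProbabilityMeasure μ'] {Y : E → ℝ}

theorem pathLaw_decidedBy (hY : Measurable Y)
    (h : μ' = μ.withDensity fun x => ENNReal.ofReal (Real.exp (Y x))) (τ : SeqTest E)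
    (i : Fin 2) (N : ℕ) :
    pathLaw μ' (τ.decidedBy i N) =
      ∫⁻ ω in τ.decidedBy i N, ENNReal.ofReal (Real.exp (stoppedWalk Y τ N ω)) ∂pathLaw μ := by
  refine pathLaw_eq_setLIntegral_exp_stoppedWalk hY h τ (fun k hk => ?_) ?_
  · rw [τ.decidedBy_inter_eq i hk]
    exact τ.measurableSet_T_D k i
  · rw [τ.decidedBy_inter_lt]
    exact @MeasurableSet.empty _ (obsSigma E N)

theorem pathLaw_compl_decidedBy (hY : Measurable Y)
    (h : μ' = μ.withDensity fun x => ENNReal.ofReal (Real.exp (Y x))) (τ : SeqTest E)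
    (i : Fin 2) (N : ℕ) :
    pathLaw μ' (τ.decidedBy i N)ᶜ =
      ∫⁻ ω in (τ.decidedBy i N)ᶜ,
        ENNReal.ofReal (Real.exp (stoppedWalk Y τ N ω)) ∂pathLaw μ := by
  refine pathLaw_eq_setLIntegral_exp_stoppedWalk hY h τ (fun k hk => ?_) ?_
  · have : (τ.decidedBy i N)ᶜ ∩ {ω | τ.T ω = k} =
        {ω | τ.T ω = k} \ {ω | τ.T ω = k ∧ τ.D ω = i} := by
      rw [← τ.decidedBy_inter_eq i hk]
      ext ω
      simp only [Set.mem_inter_iff, Set.mem_compl_iff, Set.mem_sdiff]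
      tauto
    rw [this]
    exact (τ.measurableSet_T k).diff (τ.measurableSet_T_D k i)
  · have : (τ.decidedBy i N)ᶜ ∩ {ω | (N : ℕ∞) < τ.T ω} = {ω | (N : ℕ∞) < τ.T ω} := by
      rw [Set.inter_eq_right, Set.subset_compl_iff_disjoint_left, Set.disjoint_iff_inter_eq_empty]
      exact τ.decidedBy_inter_lt i N
    rw [this]
    exact τ.measurableSet_lt_T N

/-- Let `G` be the event of stopping by `N` with decision `i`, and add `-log β` to the stopped walk
on `G`, giving `W`. By change of measure `E exp W = P'(G) / β + P'(Gᶜ) ≤ 2`, so Jensen gives `E W ≤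
log 2`, while Wald's identity computes `E W`. Truncation at `N` removes any integrability question
about `T`. -/
theorem decidedBy_log_le (hY : Measurable Y) (hYi : Integrable Y μ)
    (h : μ' = μ.withDensity fun x => ENNReal.ofReal (Real.exp (Y x))) (τ : SeqTest E)
    {i : Fin 2} {β : ℝ} (hβ : 0 < β) (hτ : pathLaw μ' {ω | τ.D ω = i} ≤ ENNReal.ofReal β)
    (N : ℕ) :
    (pathLaw μ).real (τ.decidedBy i N) * -Real.log β - Real.log 2 ≤
      -(∫ x, Y x ∂μ) * ∑ k ∈ Finset.range N, (pathLaw μ).real {ω | (k : ℕ∞) < τ.T ω} := by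
  set G := τ.decidedBy i N with hGdef
  have hG : MeasurableSet G := τ.measurableSet_decidedBy i N
  obtain ⟨hsi, hse⟩ := integral_stoppedWalk μ hY hYi τ N
  let W : (ℕ → E) → ℝ := fun ω => stoppedWalk Y τ N ω + G.indicator (fun _ => -Real.log β) ω
  have hWm : Measurable W :=
    (measurable_stoppedWalk hY τ N).add (measurable_const.indicator hG)
  have hci : Integrable (G.indicator fun _ => -Real.log β) (pathLaw μ) :=
    (integrable_const _).indicator hG
  have hWi : Integrable W (pathLaw μ) := hsi.add hci
  have hWe : ∫ ω, W ω ∂pathLaw μ = (∫ x, Y x ∂μ) *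
      ∑ k ∈ Finset.range N, (pathLaw μ).real {ω | (k : ℕ∞) < τ.T ω} +
        (pathLaw μ).real G * -Real.log β := by
    rw [integral_add hsi hci, hse, integral_indicator_const _ hG, smul_eq_mul]
  have hexp : ∫⁻ ω, ENNReal.ofReal (Real.exp (W ω)) ∂pathLaw μ ≤ 2 := by
    rw [← lintegral_add_compl _ hG, ← one_add_one_eq_two]
    refine add_le_add ?_ ?_
    · calc _ = ∫⁻ ω in G, ENNReal.ofReal β⁻¹ *
            ENNReal.ofReal (Real.exp (stoppedWalk Y τ N ω)) ∂pathLaw μ := by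
            refine setLIntegral_congr_fun hG fun ω hω => ?_
            simp only [W, Set.indicator_of_mem hω]
            rw [Real.exp_add, Real.exp_neg, Real.exp_log hβ, mul_comm,
              ENNReal.ofReal_mul (inv_nonneg.2 hβ.le)]
        _ = ENNReal.ofReal β⁻¹ * pathLaw μ' G := by
            rw [lintegral_const_mul _ (by
              have := measurable_stoppedWalk hY τ N
              fun_prop), pathLaw_decidedBy hY h]
        _ ≤ ENNReal.ofReal β⁻¹ * ENNReal.ofReal β := by
            gcongr
            exact (measure_mono fun ω hω => hω.2).trans hτ
        _ = 1 := by
            rw [← ENNReal.ofReal_mul (inv_nonneg.2 hβ.le), inv_mul_cancel₀ hβ.ne',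
              ENNReal.ofReal_one]
    · calc _ = ∫⁻ ω in Gᶜ, ENNReal.ofReal (Real.exp (stoppedWalk Y τ N ω)) ∂pathLaw μ := by
            refine setLIntegral_congr_fun hG.compl fun ω hω => ?_
            simp only [W, Set.indicator_of_notMem hω, add_zero]
        _ = pathLaw μ' Gᶜ := (pathLaw_compl_decidedBy hY h τ i N).symm
        _ ≤ 1 := prob_le_one
  have hei : Integrable (fun ω => Real.exp (W ω)) (pathLaw μ) :=
    ⟨(Real.measurable_exp.comp hWm).aestronglyMeasurable, by
      rw [hasFiniteIntegral_iff_ofReal (ae_of_all _ fun _ => (Real.exp_pos _).le)]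
      exact hexp.trans_lt (by simp)⟩
  have hee : ∫ ω, Real.exp (W ω) ∂pathLaw μ ≤ 2 := by
    rw [integral_eq_lintegral_of_nonneg_ae (ae_of_all _ fun _ => (Real.exp_pos _).le)
      hei.aestronglyMeasurable]
    exact ENNReal.toReal_mono (by simp) hexp
  -- Jensen through the tangent line of `exp` at `log 2`: `w ≤ exp w / 2 + log 2 - 1`.
  have key : ∫ ω, W ω ∂pathLaw μ ≤ ∫ ω, (Real.exp (W ω) / 2 + (Real.log 2 - 1)) ∂pathLaw μ := by
    refine integral_mono hWi ((hei.div_const 2).add (integrable_const _)) fun ω => ?_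
    have := Real.add_one_le_exp (W ω - Real.log 2)
    rw [Real.exp_sub, Real.exp_log two_pos] at this
    simp only
    linarith
  rw [integral_add (hei.div_const 2) (integrable_const _), integral_div, hWe] at key
  simp at key
  linarith

/-- Wald's lower bound for the expected sample size under the null hypothesis. -/
theorem ofReal_le_expSampleSize (hY : Measurable Y) (hYi : Integrable Y μ)
    (h : μ' = μ.withDensity fun x => ENNReal.ofReal (Real.exp (Y x)))
    {J : ℝ} (hJ : 0 < J) (hJY : ∫ x, Y x ∂μ = -J) (τ : SeqTest E)
    {i j : Fin 2} (hij : i ≠ j) {α β : ℝ} (hα : 0 < α) (hβ : 0 < β) (hβ1 : β < 1)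
    (hτi : pathLaw μ' {ω | τ.D ω = i} ≤ ENNReal.ofReal β)
    (hτj : pathLaw μ {ω | τ.D ω = j} ≤ ENNReal.ofReal α) :
    ENNReal.ofReal (((1 - α) * -Real.log β - Real.log 2) / J) ≤
      expSampleSize (pathLaw μ) τ := by
  by_cases htop : expSampleSize (pathLaw μ) τ = ∞
  · simp [htop]
  rw [expSampleSize_eq_tsum] at htop ⊢
  have hp : Tendsto (fun N : ℕ => (pathLaw μ).real {ω | (N : ℕ∞) < τ.T ω}) atTop (𝓝 0) :=
    (ENNReal.tendsto_toReal_zero_iff (fun _ => measure_ne_top _ _)).2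
      (ENNReal.tendsto_atTop_zero_of_tsum_ne_top htop)
  rw [ENNReal.ofReal_le_iff_le_toReal htop, div_le_iff₀' hJ]
  have hlog : 0 < -Real.log β := neg_pos.2 (Real.log_neg hβ hβ1)
  have hlim : Tendsto (fun N : ℕ => (1 - α - (pathLaw μ).real {ω | (N : ℕ∞) < τ.T ω}) *
      -Real.log β - Real.log 2) atTop (𝓝 ((1 - α - 0) * -Real.log β - Real.log 2)) :=
    ((tendsto_const_nhds.sub hp).mul_const _).sub_const _
  rw [sub_zero] at hlim
  refine le_of_tendsto hlim (Eventually.of_forall fun N => ?_)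
  have h1 := decidedBy_log_le hY hYi h τ hβ hτi N
  rw [hJY, neg_neg] at h1
  -- A path outside the event has either `D = j`, of probability at most `α`, or `T > N`, whose
  -- probability vanishes as `N → ∞`.
  have h2 : 1 - α - (pathLaw μ).real {ω | (N : ℕ∞) < τ.T ω} ≤
      (pathLaw μ).real (τ.decidedBy i N) := by
    have hcov : (Set.univ : Set (ℕ → E)) ⊆
        (τ.decidedBy i N ∪ {ω | τ.D ω = j}) ∪ {ω | (N : ℕ∞) < τ.T ω} := by
      intro ω _
      by_cases hN : (N : ℕ∞) < τ.T ω
      · exact Or.inr hN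
      · refine Or.inl ?_
        by_cases hD : τ.D ω = j
        · exact Or.inr hD
        · exact Or.inl ⟨not_lt.1 hN, by omega⟩
    have h3 := (measureReal_mono (μ := pathLaw μ) hcov).trans
      ((measureReal_union_le _ _).trans (add_le_add_left (measureReal_union_le _ _) _))
    rw [probReal_univ] at h3
    have h4 : (pathLaw μ).real {ω | τ.D ω = j} ≤ α :=
      ENNReal.toReal_le_of_le_ofReal hα.le hτj
    linarith
  have h5 : ∑ k ∈ Finset.range N, (pathLaw μ).real {ω | (k : ℕ∞) < τ.T ω} ≤
      (∑' k : ℕ, pathLaw μ {ω | (k : ℕ∞) < τ.T ω}).toReal := by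
    simp only [measureReal_def]
    rw [← ENNReal.toReal_sum fun _ _ => measure_ne_top _ _]
    exact ENNReal.toReal_mono htop (ENNReal.sum_le_tsum _)
  have h6 := mul_le_mul_of_nonneg_right h2 hlog.le
  have h7 := mul_le_mul_of_nonneg_left h5 hJ.le
  linarith

/-- Wald's bound for the error probabilities of a sequential probability ratio test. -/
theorem pathLaw_D_le (hY : Measurable Y)
    (h : μ' = μ.withDensity fun x => ENNReal.ofReal (Real.exp (Y x))) (τ : SeqTest E)
    {i : Fin 2} {c : ℝ} (hτ : ∀ ω (n : ℕ), τ.T ω = n → τ.D ω = i → walk Y n ω ≤ -c)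
    (hinf : pathLaw μ' {ω | τ.T ω = ⊤ ∧ τ.D ω = i} = 0) :
    pathLaw μ' {ω | τ.D ω = i} ≤ ENNReal.ofReal (Real.exp (-c)) := by
  have hcov : {ω | τ.D ω = i} ⊆ {ω | τ.T ω = ⊤ ∧ τ.D ω = i} ∪ ⋃ N, τ.decidedBy i N := by
    intro ω hω
    by_cases hT : τ.T ω = ⊤
    · exact Or.inl ⟨hT, hω⟩
    · obtain ⟨n, hn⟩ := ENat.ne_top_iff_exists.1 hT
      exact Or.inr (Set.mem_iUnion.2 ⟨n, hn.symm.le, hω⟩)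
  refine (measure_mono hcov).trans ((measure_union_le _ _).trans ?_)
  rw [hinf, zero_add, Monotone.measure_iUnion]
  · refine iSup_le fun N => ?_
    rw [pathLaw_decidedBy hY h]
    calc _ ≤ ∫⁻ ω in τ.decidedBy i N, ENNReal.ofReal (Real.exp (-c)) ∂pathLaw μ := by
          refine setLIntegral_mono measurable_const fun ω hω => ?_
          obtain ⟨n, hn⟩ := ENat.ne_top_iff_exists.1
            (ne_top_of_le_ne_top (ENat.natCast_ne_top N) hω.1)
          have hnN : n ≤ N := by
            have := hω.1
            rw [← hn] at this
            exact_mod_cast this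
          rw [stoppedWalk_of_eq hn.symm hnN]
          gcongr
          exact hτ ω n hn.symm hω.2
      _ ≤ ENNReal.ofReal (Real.exp (-c)) := by
          rw [setLIntegral_const]
          exact mul_le_of_le_one_right' prob_le_one
  · intro m n hmn ω hω
    exact ⟨hω.1.trans (by exact_mod_cast hmn), hω.2⟩

end ChangeOfMeasure

/-- Before stopping the walk is at most `A`, and one more step adds at most `M`; so the walk at `T ∧
N` is at most `A + M`, and Wald's identity bounds `E[T ∧ N]` uniformly in `N`. In particular `T` is
shown, not assumed, to be integrable. -/
theorem expSampleSize_le_of_le {μ : Measure E} [IsProbabilityMeasure μ] {Y : E → ℝ}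
    (hY : Measurable Y) (hYi : Integrable Y μ) {M A : ℝ} (hM : 0 ≤ M) (hYM : ∀ x, Y x ≤ M)
    (hJ : 0 < ∫ x, Y x ∂μ) (τ : SeqTest E)
    (hτ : ∀ ω (k : ℕ), (k : ℕ∞) < τ.T ω → walk Y k ω ≤ A) :
    expSampleSize (pathLaw μ) τ ≤ ENNReal.ofReal ((A + M) / ∫ x, Y x ∂μ) := by
  rw [expSampleSize_eq_tsum]
  refine ENNReal.tsum_le_of_sum_range_le fun N => ?_
  have hle : ∀ ω, stoppedWalk Y τ N ω ≤ A + M := by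
    intro ω
    by_cases hN : (N : ℕ∞) < τ.T ω
    · rw [stoppedWalk_of_lt hN]
      linarith [hτ ω N hN]
    · rw [not_lt] at hN
      obtain ⟨n, hn⟩ := ENat.ne_top_iff_exists.1 (ne_top_of_le_ne_top (ENat.natCast_ne_top N) hN)
      have h1 := τ.one_le_T ω
      rw [← hn] at hN h1
      have hnN : n ≤ N := by exact_mod_cast hN
      have hn1 : 1 ≤ n := by exact_mod_cast h1
      rw [stoppedWalk_of_eq hn.symm hnN]
      obtain ⟨k, rfl⟩ := Nat.exists_eq_add_of_le' hn1
      have := hτ ω k (by rw [← hn]; exact_mod_cast Nat.lt_succ_self k)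
      rw [walk, Finset.sum_range_succ]
      exact add_le_add this (hYM _)
  obtain ⟨hi, he⟩ := integral_stoppedWalk μ hY hYi τ N
  have hint : ∫ ω, stoppedWalk Y τ N ω ∂pathLaw μ ≤ A + M := by
    refine (integral_mono hi (integrable_const (A + M)) hle).trans ?_
    simp
  rw [he, ← le_div_iff₀' hJ] at hint
  rw [ENNReal.le_ofReal_iff_toReal_le (ENNReal.sum_ne_top.2 fun _ _ => measure_ne_top _ _)
    (le_trans (Finset.sum_nonneg fun _ _ => measureReal_nonneg) hint),
    ENNReal.toReal_sum fun _ _ => measure_ne_top _ _]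
  exact hint

/-! ### The sequential probability ratio test -/

/-- The walk `walk Y` is outside `(-a, b)` at the positive time `n`. -/
def exitAt (Y : E → ℝ) (a b : ℝ) (n : ℕ) (ω : ℕ → E) : Prop :=
  1 ≤ n ∧ ¬(-a < walk Y n ω ∧ walk Y n ω < b)

/-- `n` is the first positive time at which the walk is outside `(-a, b)`. -/
def firstExitAt (Y : E → ℝ) (a b : ℝ) (n : ℕ) (ω : ℕ → E) : Prop :=
  exitAt Y a b n ω ∧ ∀ k < n, ¬exitAt Y a b k ω

theorem measurableSet_exitAt {Y : E → ℝ} (hY : Measurable Y) (a b : ℝ) {k n : ℕ} (hk : k ≤ n) :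
    MeasurableSet[obsSigma E n] {ω | exitAt Y a b k ω} := by
  have hw := measurable_walk_obsSigma hY hk
  exact (@MeasurableSet.const _ (obsSigma E n) _).inter
    ((hw measurableSet_Ioi).inter (hw measurableSet_Iio)).compl

theorem measurableSet_firstExitAt {Y : E → ℝ} (hY : Measurable Y) (a b : ℝ) (n : ℕ) :
    MeasurableSet[obsSigma E n] {ω | firstExitAt Y a b n ω} := by
  have : {ω | firstExitAt Y a b n ω} =
      {ω | exitAt Y a b n ω} ∩ ⋂ k ∈ Finset.range n, {ω | exitAt Y a b k ω}ᶜ := by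
    ext ω
    simp [firstExitAt]
  rw [this]
  refine MeasurableSet.inter (measurableSet_exitAt hY a b le_rfl)
    (Finset.measurableSet_biInter _ fun k hk => ?_)
  exact (measurableSet_exitAt hY a b (Finset.mem_range.1 hk).le).compl

open Classical in
/-- The first exit time of the walk from `(-a, b)`. -/
noncomputable def exitTime (Y : E → ℝ) (a b : ℝ) (ω : ℕ → E) : ℕ∞ :=
  if h : ∃ n, exitAt Y a b n ω then (Nat.find h : ℕ∞) else ⊤

omit [MeasurableSpace E] in
theorem exitTime_eq_iff {Y : E → ℝ} {a b : ℝ} {ω : ℕ → E} {n : ℕ} :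
    exitTime Y a b ω = n ↔ firstExitAt Y a b n ω := by
  classical
  unfold exitTime firstExitAt
  split_ifs with h
  · rw [Nat.cast_inj, Nat.find_eq_iff]
  · simp only [ENat.top_ne_natCast, false_iff]
    exact fun hn => h ⟨n, hn.1⟩

omit [MeasurableSpace E] in
theorem not_exitAt_of_lt_exitTime {Y : E → ℝ} {a b : ℝ} {ω : ℕ → E} {k : ℕ}
    (h : (k : ℕ∞) < exitTime Y a b ω) : ¬exitAt Y a b k ω := by
  classical
  unfold exitTime at h
  split_ifs at h with h1
  · exact Nat.find_min h1 (by exact_mod_cast h)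
  · exact fun hk => h1 ⟨k, hk⟩

open Classical in
/-- Wald's sequential probability ratio test with thresholds `-a` and `b`, where `Y` is the
log-likelihood ratio of an observation. -/
noncomputable def sprt {Y : E → ℝ} (hY : Measurable Y) (a b : ℝ) : SeqTest E where
  T := exitTime Y a b
  -- On paths that never exit, `D` defaults to `0`; only the type-II error then needs `T < ∞` almost
  -- surely.
  D ω := if ∃ n, firstExitAt Y a b n ω ∧ b ≤ walk Y n ω then 1 else 0
  one_le_T ω := by
    unfold exitTime
    split_ifs with h
    · exact_mod_cast (Nat.find_spec h).1
    · exact le_top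
  measurableSet_T n := by
    simp only [exitTime_eq_iff]
    exact measurableSet_firstExitAt hY a b n
  measurable_D := by
    refine Measurable.ite ?_ measurable_const measurable_const
    have : {ω | ∃ n, firstExitAt Y a b n ω ∧ b ≤ walk Y n ω} =
        ⋃ n, {ω | firstExitAt Y a b n ω} ∩ walk Y n ⁻¹' Set.Ici b := by
      ext ω
      simp
    rw [this]
    exact .iUnion fun n => (obsSigma_le n _ (measurableSet_firstExitAt hY a b n)).inter
      (measurable_walk hY n measurableSet_Ici)
  measurableSet_T_D n i := by
    have hu : ∀ ω, firstExitAt Y a b n ω →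
        ((∃ k, firstExitAt Y a b k ω ∧ b ≤ walk Y k ω) ↔ b ≤ walk Y n ω) := by
      intro ω hω
      constructor
      · rintro ⟨k, hk, hb⟩
        have : (k : ℕ∞) = n := (exitTime_eq_iff.2 hk).symm.trans (exitTime_eq_iff.2 hω)
        rwa [← Nat.cast_inj.1 this]
      · exact fun hb => ⟨n, hω, hb⟩
    have hF := measurableSet_firstExitAt hY a b n
    have hb := measurable_walk_obsSigma hY (le_refl n) (measurableSet_Ici (a := b))
    have : {ω | exitTime Y a b ω = n ∧
        (if ∃ n, firstExitAt Y a b n ω ∧ b ≤ walk Y n ω then (1 : Fin 2) else 0) = i} =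
        {ω | firstExitAt Y a b n ω} ∩
          (if i = 1 then walk Y n ⁻¹' Set.Ici b else (walk Y n ⁻¹' Set.Ici b)ᶜ) := by
      ext ω
      simp only [exitTime_eq_iff, Set.mem_ofPred_eq, Set.mem_inter_iff]
      refine and_congr_right fun hω => ?_
      rw [if_congr (hu ω hω) rfl rfl]
      fin_cases i <;> simp
    rw [this]
    split_ifs
    exacts [hF.inter hb, hF.inter hb.compl]

section Sprt

variable {Y : E → ℝ} (hY : Measurable Y) {a b : ℝ}

theorem sprt_walk_of_lt (ha : 0 < a) (hb : 0 < b) {ω : ℕ → E} {k : ℕ}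
    (h : (k : ℕ∞) < (sprt hY a b).T ω) : -a < walk Y k ω ∧ walk Y k ω < b := by
  -- Time `0` is never an exit time by definition; there the walk is `0`, inside the interval as `a,
  -- b > 0`.
  rcases Nat.eq_zero_or_pos k with rfl | hk
  · simp [walk, ha, hb]
  · have := not_exitAt_of_lt_exitTime h
    by_contra hc
    exact this ⟨hk, hc⟩

theorem sprt_walk_of_one {ω : ℕ → E} {n : ℕ} (hT : (sprt hY a b).T ω = n)
    (hD : (sprt hY a b).D ω = 1) : b ≤ walk Y n ω := by
  classical
  change exitTime Y a b ω = n at hT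
  simp only [sprt] at hD
  split_ifs at hD with h
  · obtain ⟨k, hk, hb⟩ := h
    have : (k : ℕ∞) = n := (exitTime_eq_iff.2 hk).symm.trans hT
    rwa [← Nat.cast_inj.1 this]
  · simp at hD

theorem sprt_walk_of_zero {ω : ℕ → E} {n : ℕ} (hT : (sprt hY a b).T ω = n)
    (hD : (sprt hY a b).D ω = 0) : walk Y n ω ≤ -a := by
  classical
  have hF : firstExitAt Y a b n ω := exitTime_eq_iff.1 hT
  simp only [sprt] at hD
  split_ifs at hD with h
  · simp at hD
  · by_contra hc
    exact hF.1.2 ⟨not_le.1 hc, not_le.1 fun hb => h ⟨n, hF, hb⟩⟩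

theorem sprt_T_ne_top_of_one {ω : ℕ → E} (hD : (sprt hY a b).D ω = 1) :
    (sprt hY a b).T ω ≠ ⊤ := by
  classical
  simp only [sprt] at hD
  split_ifs at hD with h
  · obtain ⟨k, hk, -⟩ := h
    change exitTime Y a b ω ≠ ⊤
    rw [exitTime_eq_iff.2 hk]
    simp
  · simp at hD

end Sprt

theorem measure_T_eq_top (P : Measure (ℕ → E)) (τ : SeqTest E) (h : expSampleSize P τ ≠ ∞) :
    P {ω | τ.T ω = ⊤} = 0 := by
  rw [expSampleSize_eq_tsum] at h
  refine le_antisymm (ge_of_tendsto (ENNReal.tendsto_atTop_zero_of_tsum_ne_top h)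
    (Eventually.of_forall fun n => measure_mono fun ω hω => ?_)) zero_le
  change (n : ℕ∞) < τ.T ω
  rw [show τ.T ω = ⊤ from hω]
  simp

/-- The sequential probability ratio test with thresholds `log β` and `-log α`. -/
theorem exists_mem_testClass {μ₀ μ₁ : Measure E} [IsProbabilityMeasure μ₀]
    [IsProbabilityMeasure μ₁] {Y : E → ℝ} (hY : Measurable Y)
    (h₁ : μ₁ = μ₀.withDensity fun x => ENNReal.ofReal (Real.exp (Y x)))
    (h₀ : μ₀ = μ₁.withDensity fun x => ENNReal.ofReal (Real.exp (-Y x)))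
    (hi₀ : Integrable Y μ₀) (hi₁ : Integrable Y μ₁) {M : ℝ} (hM : 0 ≤ M)
    (hJ₀ : 0 < ∫ x, min (-Y x) M ∂μ₀) (hJ₁ : 0 < ∫ x, min (Y x) M ∂μ₁)
    {α β : ℝ} (hα : α ∈ Set.Ioo (0 : ℝ) 1) (hβ : β ∈ Set.Ioo (0 : ℝ) 1) :
    ∃ τ ∈ testClass μ₀ μ₁ α β,
      expSampleSize (pathLaw μ₀) τ ≤
        ENNReal.ofReal ((-Real.log β + M) / ∫ x, min (-Y x) M ∂μ₀) ∧
      expSampleSize (pathLaw μ₁) τ ≤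
        ENNReal.ofReal ((-Real.log α + M) / ∫ x, min (Y x) M ∂μ₁) := by
  have ha : 0 < -Real.log β := neg_pos.2 (Real.log_neg hβ.1 hβ.2)
  have hb : 0 < -Real.log α := neg_pos.2 (Real.log_neg hα.1 hα.2)
  set τ := sprt hY (-Real.log β) (-Real.log α) with hτ
  have hE₀ : expSampleSize (pathLaw μ₀) τ ≤
      ENNReal.ofReal ((-Real.log β + M) / ∫ x, min (-Y x) M ∂μ₀) := by
    refine expSampleSize_le_of_le (Y := fun x => min (-Y x) M) (hY.neg.min measurable_const)
      (hi₀.neg.inf (integrable_const M)) hM (fun x => min_le_right _ _) hJ₀ τ fun ω k hk => ?_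
    have h1 := (sprt_walk_of_lt hY ha hb hk).1
    -- Capping steps only lowers the walk, so the boundary that bounds the original walk also bounds
    -- the capped one.
    have h2 : walk (fun x => min (-Y x) M) k ω ≤ walk (fun x => -Y x) k ω :=
      Finset.sum_le_sum fun _ _ => min_le_left _ _
    rw [walk_neg] at h2
    linarith
  have hE₁ : expSampleSize (pathLaw μ₁) τ ≤
      ENNReal.ofReal ((-Real.log α + M) / ∫ x, min (Y x) M ∂μ₁) := by
    refine expSampleSize_le_of_le (hY.min measurable_const)
      (hi₁.inf (integrable_const M)) hM (fun x => min_le_right _ _) hJ₁ τ fun ω k hk => ?_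
    have h1 := (sprt_walk_of_lt hY ha hb hk).2
    have h2 : walk (fun x => min (Y x) M) k ω ≤ walk Y k ω :=
      Finset.sum_le_sum fun _ _ => min_le_left _ _
    linarith
  refine ⟨τ, ⟨?_, ?_⟩, hE₀, hE₁⟩
  · have := pathLaw_D_le (μ := μ₁) (μ' := μ₀) hY.neg h₀ τ (i := 1) (c := -Real.log α) ?_ ?_
    · rwa [neg_neg, Real.exp_log hα.1] at this
    · intro ω n hT hD
      have h1 := sprt_walk_of_one hY hT hD
      have h2 := walk_neg Y n ω
      change walk (fun x => -Y x) n ω ≤ _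
      linarith
    · have : {ω | τ.T ω = ⊤ ∧ τ.D ω = 1} = ∅ := by
        ext ω
        simp only [Set.mem_ofPred_eq, Set.mem_empty_iff_false, iff_false]
        exact fun h => sprt_T_ne_top_of_one hY h.2 h.1
      rw [this, measure_empty]
  · have := pathLaw_D_le (μ := μ₀) (μ' := μ₁) hY h₁ τ (i := 0) (c := -Real.log β)
      (fun ω n hT hD => sprt_walk_of_zero hY hT hD)
      -- The finite expectation just proved under `μ₁` makes `T` finite almost surely there.
      (measure_mono_null (fun ω hω => hω.1)
        (measure_T_eq_top _ τ (hE₁.trans_lt ENNReal.ofReal_lt_top).ne))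
    rwa [neg_neg, Real.exp_log hβ.1] at this

/-- Dominated by `|Y|`. It allows a fixed cap on the steps at an arbitrarily small relative cost in
the drift. -/
theorem tendsto_integral_min {μ : Measure E} {Y : E → ℝ} (hi : Integrable Y μ) :
    Tendsto (fun n : ℕ => ∫ x, min (Y x) n ∂μ) atTop (𝓝 (∫ x, Y x ∂μ)) := by
  refine tendsto_integral_of_dominated_convergence (fun x => |Y x|)
    (fun n => (hi.aestronglyMeasurable.inf aestronglyMeasurable_const)) hi.abs
    (fun n => ae_of_all _ fun x => ?_) (ae_of_all _ fun x => ?_)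
  · have hn : (0 : ℝ) ≤ n := n.cast_nonneg
    rw [Real.norm_eq_abs, abs_le]
    refine ⟨le_min (neg_abs_le _) ?_, (min_le_left _ _).trans (le_abs_self _)⟩
    linarith [abs_nonneg (Y x)]
  · refine tendsto_const_nhds.congr' ?_
    obtain ⟨k, hk⟩ := exists_nat_ge (Y x)
    filter_upwards [eventually_ge_atTop k] with n hn
    rw [min_eq_left]
    exact hk.trans (by exact_mod_cast hn)

end

/-! ### Asymptotics of the error levels -/

section Levels

variable {γ : ℝ}

theorem one_sub_rpow_eq (hγ : γ ∈ Set.Ioo (0 : ℝ) 1) (k : ℝ) :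
    1 - (1 - γ) ^ (1 / k) = 1 - Real.exp (-(-Real.log (1 - γ) / k)) := by
  rw [Real.rpow_def_of_pos (by linarith [hγ.2])]
  congr 2
  ring

theorem neg_log_one_sub_pos (hγ : γ ∈ Set.Ioo (0 : ℝ) 1) : 0 < -Real.log (1 - γ) :=
  neg_pos.2 (Real.log_neg (by linarith [hγ.2]) (by linarith [hγ.1]))

theorem one_sub_rpow_mem_Ioo (hγ : γ ∈ Set.Ioo (0 : ℝ) 1) {k : ℝ} (hk : 0 < k) :
    1 - (1 - γ) ^ (1 / k) ∈ Set.Ioo (0 : ℝ) 1 := by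
  rw [one_sub_rpow_eq hγ]
  have h := div_pos (neg_log_one_sub_pos hγ) hk
  constructor
  · linarith [Real.exp_lt_one_iff.2 (neg_lt_zero.2 h)]
  · linarith [Real.exp_pos (-(-Real.log (1 - γ) / k))]

theorem tendsto_one_sub_rpow (hγ : γ ∈ Set.Ioo (0 : ℝ) 1) :
    Tendsto (fun k : ℝ => 1 - (1 - γ) ^ (1 / k)) atTop (𝓝 0) := by
  simp only [one_sub_rpow_eq hγ]
  have h : Tendsto (fun k : ℝ => -(-Real.log (1 - γ) / k)) atTop (𝓝 (-0)) :=
    (tendsto_const_nhds.div_atTop tendsto_id).neg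
  rw [neg_zero] at h
  have h2 := ((Real.continuous_exp.tendsto 0).comp h).const_sub 1
  simpa using h2

/-- With `a = -log (1 - γ)` the level is `1 - exp (-a/k)`, which for `k > 1` lies between `(a/k) /
(1 + a)` and `a/k`; hence minus its logarithm is `log k + O(1)`. -/
theorem tendsto_neg_log_one_sub_rpow_div_log (hγ : γ ∈ Set.Ioo (0 : ℝ) 1) :
    Tendsto (fun k : ℝ => -Real.log (1 - (1 - γ) ^ (1 / k)) / Real.log k) atTop (𝓝 1) := by
  set a := -Real.log (1 - γ) with ha_def
  have ha : 0 < a := neg_log_one_sub_pos hγ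
  have hlim : ∀ c : ℝ, Tendsto (fun k : ℝ => 1 + c / Real.log k) atTop (𝓝 1) := fun c => by
    have := (tendsto_const_nhds (x := c)).div_atTop Real.tendsto_log_atTop
    simpa using this.const_add 1
  refine tendsto_of_tendsto_of_tendsto_of_le_of_le' (hlim (-Real.log a))
    (hlim (Real.log (1 + a) - Real.log a)) ?_ ?_
  · filter_upwards [eventually_gt_atTop 1] with k hk
    have hlk := Real.log_pos hk
    have hk0 : 0 < k := by linarith
    rw [one_sub_rpow_eq hγ, ← ha_def, le_div_iff₀ hlk, add_mul, div_mul_cancel₀ _ hlk.ne', one_mul]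
    have h1 : 1 - Real.exp (-(a / k)) ≤ a / k := by
      linarith [Real.add_one_le_exp (-(a / k))]
    have h2 : 0 < 1 - Real.exp (-(a / k)) := by
      linarith [Real.exp_lt_one_iff.2 (neg_lt_zero.2 (div_pos ha hk0))]
    have h3 := Real.log_le_log h2 h1
    rw [Real.log_div ha.ne' hk0.ne'] at h3
    linarith
  · filter_upwards [eventually_gt_atTop 1] with k hk
    have hlk := Real.log_pos hk
    have hk0 : 0 < k := by linarith
    rw [one_sub_rpow_eq hγ, ← ha_def, div_le_iff₀ hlk, add_mul, div_mul_cancel₀ _ hlk.ne', one_mul]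
    have hx : 0 < a / k := div_pos ha hk0
    have hxa : a / k ≤ a := div_le_self ha.le hk.le
    have h1 : a / k / (1 + a) ≤ 1 - Real.exp (-(a / k)) := by
      have h2 : Real.exp (-(a / k)) ≤ 1 / (1 + a / k) := by
        rw [Real.exp_neg, ← one_div]
        exact one_div_le_one_div_of_le (by positivity) (by linarith [Real.add_one_le_exp (a / k)])
      have h3 : a / k / (1 + a) ≤ a / k / (1 + a / k) := by gcongr
      have h4 : 1 - 1 / (1 + a / k) = a / k / (1 + a / k) := by
        field_simp
        ring
      linarith
    have h3 := Real.log_le_log (by positivity) h1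
    rw [Real.log_div hx.ne' (by positivity), Real.log_div ha.ne' hk0.ne'] at h3
    linarith

end Levels

/-! ### Mixtures and the high-dimensional limit -/

variable {E : Type*} [MeasurableSpace E]

theorem expSampleSize_mixLaw (μ₀ μ₁ : Measure E) [IsProbabilityMeasure μ₀]
    [IsProbabilityMeasure μ₁] (π : ℝ) (τ : SeqTest E) :
    expSampleSize (mixLaw μ₀ μ₁ π) τ =
      ENNReal.ofReal (1 - π) * expSampleSize (pathLaw μ₀) τ +
        ENNReal.ofReal π * expSampleSize (pathLaw μ₁) τ := by
  simp [expSampleSize, mixLaw, lintegral_add_measure, lintegral_smul_measure]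

/-- Up to a relative error `δ`, `p` and `q` are the smallest possible expected sample sizes in
`ℰ(α, β)` under `P₀` and `P₁`, and they are attained simultaneously. -/
structure SizeBounds (μ₀ μ₁ : Measure E) [IsProbabilityMeasure μ₀] [IsProbabilityMeasure μ₁]
    (α β p q δ : ℝ) : Prop where
  le₀ : ∀ τ ∈ testClass μ₀ μ₁ α β, ENNReal.ofReal ((1 - δ) * p) ≤ expSampleSize (pathLaw μ₀) τ
  le₁ : ∀ τ ∈ testClass μ₀ μ₁ α β, ENNReal.ofReal ((1 - δ) * q) ≤ expSampleSize (pathLaw μ₁) τ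
  ge : ∃ τ ∈ testClass μ₀ μ₁ α β,
    expSampleSize (pathLaw μ₀) τ ≤ ENNReal.ofReal ((1 + δ) * p) ∧
    expSampleSize (pathLaw μ₁) τ ≤ ENNReal.ofReal ((1 + δ) * q)

theorem ofReal_convexComb {π x y : ℝ} (h0 : 0 ≤ π) (h1 : π ≤ 1) (hx : 0 ≤ x) (hy : 0 ≤ y) :
    ENNReal.ofReal (1 - π) * ENNReal.ofReal x + ENNReal.ofReal π * ENNReal.ofReal y =
      ENNReal.ofReal ((1 - π) * x + π * y) := by
  rw [← ENNReal.ofReal_mul (by linarith), ← ENNReal.ofReal_mul h0,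
    ← ENNReal.ofReal_add (mul_nonneg (by linarith) hx) (mul_nonneg h0 hy)]

theorem convexComb_pos {π x y : ℝ} (h0 : 0 ≤ π) (h1 : π ≤ 1) (hx : 0 < x) (hy : 0 < y) :
    0 < (1 - π) * x + π * y := by
  rcases h0.eq_or_lt with rfl | h
  · simpa using hx
  · have := mul_pos h hy
    have := mul_nonneg (sub_nonneg.2 h1) hx.le
    linarith

/-- Below, the two endpoint bounds hold for each test and are averaged; above, the same test serves
at both endpoints. The error `δ` does not depend on `π`, whence the uniformity in `s`. -/
theorem SizeBounds.optSampleSize_mem {μ₀ μ₁ : Measure E} [IsProbabilityMeasure μ₀]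
    [IsProbabilityMeasure μ₁] {α β p q δ : ℝ} (h : SizeBounds μ₀ μ₁ α β p q δ) (hp : 0 ≤ p)
    (hq : 0 ≤ q) (hδ : 0 ≤ δ) (hδ1 : δ ≤ 1) {π : ℝ} (h0 : 0 ≤ π) (h1 : π ≤ 1) :
    ENNReal.ofReal ((1 - δ) * ((1 - π) * p + π * q)) ≤
        optSampleSize μ₀ μ₁ (mixLaw μ₀ μ₁ π) α β ∧
      optSampleSize μ₀ μ₁ (mixLaw μ₀ μ₁ π) α β ≤
        ENNReal.ofReal ((1 + δ) * ((1 - π) * p + π * q)) := by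
  have e : ∀ c : ℝ, c * ((1 - π) * p + π * q) = (1 - π) * (c * p) + π * (c * q) := fun c => by ring
  constructor
  · refine le_iInf₂ fun τ hτ => ?_
    rw [e, ← ofReal_convexComb h0 h1 (mul_nonneg (by linarith) hp) (mul_nonneg (by linarith) hq),
      expSampleSize_mixLaw]
    gcongr
    exacts [h.le₀ τ hτ, h.le₁ τ hτ]
  · obtain ⟨τ, hτ, hτ0, hτ1⟩ := h.ge
    refine (iInf₂_le τ hτ).trans ?_
    rw [e, ← ofReal_convexComb h0 h1 (mul_nonneg (by linarith) hp) (mul_nonneg (by linarith) hq),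
      expSampleSize_mixLaw]
    gcongr

theorem tendsto_sub_natCast_atTop {l : ℕ → ℕ} (hl : Tendsto (fun m : ℕ => m - l m) atTop atTop) :
    Tendsto (fun m : ℕ => (m : ℝ) - l m) atTop atTop := by
  refine (tendsto_natCast_atTop_atTop.comp hl).congr' ?_
  filter_upwards [hl.eventually_ge_atTop 1] with m hm
  simp only [Function.comp]
  rw [Nat.cast_sub (by omega)]

theorem eventually_levels {l u : ℕ → ℕ} (hu : Tendsto u atTop atTop)
    (hl : Tendsto (fun m : ℕ => m - l m) atTop atTop) {α β : ℝ} (hα : α ∈ Set.Ioo (0 : ℝ) 1)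
    (hβ : β ∈ Set.Ioo (0 : ℝ) 1) :
    ∀ᶠ m : ℕ in atTop, alphaM l α m ∈ Set.Ioo (0 : ℝ) 1 ∧ betaM u β m ∈ Set.Ioo (0 : ℝ) 1 ∧
      0 < Real.log (u m) ∧ 0 < Real.log ((m : ℝ) - l m) := by
  have hu' : Tendsto (fun m => (u m : ℝ)) atTop atTop := tendsto_natCast_atTop_atTop.comp hu
  filter_upwards [hu'.eventually_gt_atTop 1,
    (tendsto_sub_natCast_atTop hl).eventually_gt_atTop 1] with m h1 h2
  exact ⟨one_sub_rpow_mem_Ioo hα (by linarith), one_sub_rpow_mem_Ioo hβ (by linarith),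
    Real.log_pos h1, Real.log_pos h2⟩

theorem tendsto_lower_ratio {γ : ℕ → ℝ} {b w : ℕ → ℝ} {I : ℝ} (hI : 0 < I)
    (hγ : Tendsto γ atTop (𝓝 0)) (hw : Tendsto w atTop atTop)
    (hb : Tendsto (fun m => b m / w m) atTop (𝓝 1)) :
    Tendsto (fun m => ((1 - γ m) * b m - Real.log 2) / I / (w m / I)) atTop (𝓝 1) := by
  have h1 : Tendsto (fun m => (1 - γ m) * (b m / w m) - Real.log 2 / w m) atTop
      (𝓝 ((1 - 0) * 1 - 0)) :=
    ((hγ.const_sub 1).mul hb).sub (tendsto_const_nhds.div_atTop hw)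
  norm_num at h1
  refine h1.congr fun m => ?_
  rw [div_div_div_cancel_right₀ hI.ne', sub_div, mul_div_assoc]

theorem tendsto_upper_ratio {b w : ℕ → ℝ} {I : ℝ} (M J : ℝ) (hw : Tendsto w atTop atTop)
    (hb : Tendsto (fun m => b m / w m) atTop (𝓝 1)) :
    Tendsto (fun m => (b m + M) / J / (w m / I)) atTop (𝓝 (I / J)) := by
  have h1 : Tendsto (fun m => (b m / w m + M / w m) * (I / J)) atTop (𝓝 ((1 + 0) * (I / J))) :=
    (hb.add (tendsto_const_nhds.div_atTop hw)).mul_const _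
  rw [add_zero, one_mul] at h1
  refine h1.congr fun m => ?_
  rw [← add_div, div_mul_div_comm, div_div_div_eq, mul_comm (w m)]

/-- The sample size under `μ₀` is governed by `β`, hence by `u`; the one under `μ₁` by `α`, hence by
`m - l m`. The bounds for `μ₁` come from those for `μ₀` by replacing `Y` with `-Y`. -/
theorem eventually_sizeBounds {μ₀ μ₁ : Measure E} [IsProbabilityMeasure μ₀]
    [IsProbabilityMeasure μ₁] {Y : E → ℝ} (hY : Measurable Y)
    (h₁ : μ₁ = μ₀.withDensity fun x => ENNReal.ofReal (Real.exp (Y x)))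
    (h₀ : μ₀ = μ₁.withDensity fun x => ENNReal.ofReal (Real.exp (-Y x)))
    (hi₀ : Integrable Y μ₀) (hi₁ : Integrable Y μ₁) {I₀ I₁ : ℝ} (hI₀ : 0 < I₀) (hI₁ : 0 < I₁)
    (hY₀ : ∫ x, Y x ∂μ₀ = -I₀) (hY₁ : ∫ x, Y x ∂μ₁ = I₁)
    {l u : ℕ → ℕ} (hu : Tendsto u atTop atTop)
    (hl : Tendsto (fun m : ℕ => m - l m) atTop atTop) {α β : ℝ} (hα : α ∈ Set.Ioo (0 : ℝ) 1)
    (hβ : β ∈ Set.Ioo (0 : ℝ) 1) {δ : ℝ} (hδ : 0 < δ) :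
    ∀ᶠ m : ℕ in atTop, SizeBounds μ₀ μ₁ (alphaM l α m) (betaM u β m)
      (Real.log (u m) / I₀) (Real.log ((m : ℝ) - l m) / I₁) δ := by
  have hu' : Tendsto (fun m => (u m : ℝ)) atTop atTop := tendsto_natCast_atTop_atTop.comp hu
  have hl' := tendsto_sub_natCast_atTop hl
  have hwu := Real.tendsto_log_atTop.comp hu'
  have hwl := Real.tendsto_log_atTop.comp hl'
  have ha0 : Tendsto (alphaM l α) atTop (𝓝 0) := (tendsto_one_sub_rpow hα).comp hl'
  have hb0 : Tendsto (betaM u β) atTop (𝓝 0) := (tendsto_one_sub_rpow hβ).comp hu'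
  have ha : Tendsto (fun m => -Real.log (alphaM l α m) / Real.log ((m : ℝ) - l m)) atTop (𝓝 1) :=
    (tendsto_neg_log_one_sub_rpow_div_log hα).comp hl'
  have hb : Tendsto (fun m => -Real.log (betaM u β m) / Real.log (u m)) atTop (𝓝 1) :=
    (tendsto_neg_log_one_sub_rpow_div_log hβ).comp hu'
  have hJ₀ : Tendsto (fun n : ℕ => ∫ x, min (-Y x) (n : ℝ) ∂μ₀) atTop (𝓝 I₀) := by
    have := tendsto_integral_min hi₀.neg
    simp only [Pi.neg_apply, integral_neg, hY₀, neg_neg] at this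
    exact this
  have hJ₁ : Tendsto (fun n : ℕ => ∫ x, min (Y x) (n : ℝ) ∂μ₁) atTop (𝓝 I₁) :=
    hY₁ ▸ tendsto_integral_min hi₁
  have hR₀ : Tendsto (fun n : ℕ => I₀ / ∫ x, min (-Y x) (n : ℝ) ∂μ₀) atTop (𝓝 1) :=
    div_self hI₀.ne' ▸ (tendsto_const_nhds (x := I₀)).div hJ₀ hI₀.ne'
  have hR₁ : Tendsto (fun n : ℕ => I₁ / ∫ x, min (Y x) (n : ℝ) ∂μ₁) atTop (𝓝 1) :=
    div_self hI₁.ne' ▸ (tendsto_const_nhds (x := I₁)).div hJ₁ hI₁.ne'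
  -- The cap `n` is fixed before `m` grows: the limiting upper ratios `I / J` are already below `1 +
  -- δ`, and `n` itself is negligible against the logarithms.
  obtain ⟨n, hn0, hn1, hn2, hn3⟩ := ((hJ₀.eventually_const_lt hI₀).and
    ((hJ₁.eventually_const_lt hI₁).and ((hR₀.eventually_lt_const (u := 1 + δ) (by linarith)).and
      (hR₁.eventually_lt_const (u := 1 + δ) (by linarith))))).exists
  filter_upwards [eventually_levels hu hl hα hβ,
    (tendsto_lower_ratio hI₀ ha0 hwu hb).eventually_const_lt (u := 1 - δ) (by linarith),
    (tendsto_lower_ratio hI₁ hb0 hwl ha).eventually_const_lt (u := 1 - δ) (by linarith),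
    (tendsto_upper_ratio n _ hwu hb).eventually_lt_const hn2,
    (tendsto_upper_ratio n _ hwl ha).eventually_lt_const hn3]
    with m ⟨hαm, hβm, hp, hq⟩ hlo0 hlo1 hup0 hup1
  simp only [Function.comp] at hlo0 hlo1 hup0 hup1
  have hp' := div_pos hp hI₀
  have hq' := div_pos hq hI₁
  rw [lt_div_iff₀ hp'] at hlo0
  rw [lt_div_iff₀ hq'] at hlo1
  rw [div_lt_iff₀ hp'] at hup0
  rw [div_lt_iff₀ hq'] at hup1
  refine ⟨fun τ hτ => ?_, fun τ hτ => ?_, ?_⟩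
  · exact (ENNReal.ofReal_le_ofReal hlo0.le).trans (ofReal_le_expSampleSize hY hi₀ h₁ hI₀ hY₀ τ
      (i := 0) (j := 1) (by decide) hαm.1 hβm.1 hβm.2 hτ.2 hτ.1)
  · exact (ENNReal.ofReal_le_ofReal hlo1.le).trans (ofReal_le_expSampleSize hY.neg hi₁.neg h₀ hI₁
      (by simp only [Pi.neg_apply, integral_neg, hY₁]) τ
      (i := 1) (j := 0) (by decide) hβm.1 hαm.1 hαm.2 hτ.1 hτ.2)
  · obtain ⟨τ, hτ, hτ0, hτ1⟩ := exists_mem_testClass hY h₁ h₀ hi₀ hi₁ n.cast_nonneg hn0 hn1 hαm hβm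
    exact ⟨τ, hτ, hτ0.trans (ENNReal.ofReal_le_ofReal hup0.le),
      hτ1.trans (ENNReal.ofReal_le_ofReal hup1.le)⟩

/-- The log-likelihood ratio of two probability measures with finite Kullback–Leibler
divergences. -/
theorem exists_logLikelihoodRatio {μ₀ μ₁ : Measure E} [IsProbabilityMeasure μ₀]
    [IsProbabilityMeasure μ₁] {I₀ I₁ : ℝ} (hI₀ : 0 < I₀) (hI₁ : 0 < I₁)
    (hKL₀ : klDiv μ₀ μ₁ = ENNReal.ofReal I₀) (hKL₁ : klDiv μ₁ μ₀ = ENNReal.ofReal I₁) :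
    ∃ Y : E → ℝ, Measurable Y ∧
      μ₁ = μ₀.withDensity (fun x => ENNReal.ofReal (Real.exp (Y x))) ∧
      μ₀ = μ₁.withDensity (fun x => ENNReal.ofReal (Real.exp (-Y x))) ∧
      Integrable Y μ₀ ∧ Integrable Y μ₁ ∧ ∫ x, Y x ∂μ₀ = -I₀ ∧ ∫ x, Y x ∂μ₁ = I₁ := by
  obtain ⟨hac₀, hint₀⟩ := klDiv_ne_top_iff.1 (hKL₀ ▸ ENNReal.ofReal_ne_top)
  obtain ⟨hac₁, hint₁⟩ := klDiv_ne_top_iff.1 (hKL₁ ▸ ENNReal.ofReal_ne_top)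
  have hv₀ := toReal_klDiv_of_measure_eq hac₀ (by simp)
  have hv₁ := toReal_klDiv_of_measure_eq hac₁ (by simp)
  rw [hKL₀, ENNReal.toReal_ofReal hI₀.le] at hv₀
  rw [hKL₁, ENNReal.toReal_ofReal hI₁.le] at hv₁
  have hneg : -llr μ₀ μ₁ =ᵐ[μ₀] llr μ₁ μ₀ := neg_llr hac₀
  -- `Real.log 0 = 0`, so exponentiating `llr` recovers the derivative only where it is positive and
  -- finite; mutual absolute continuity, from both divergences being finite, makes this hold almost
  -- everywhere.
  have hdens : ∀ (μ ν : Measure E) [IsProbabilityMeasure μ] [IsProbabilityMeasure ν], μ ≪ ν →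
      ∀ f : E → ℝ, (fun x => Real.exp (f x)) =ᵐ[ν] (fun x => (μ.rnDeriv ν x).toReal) →
      μ = ν.withDensity fun x => ENNReal.ofReal (Real.exp (f x)) := by
    intro μ ν _ _ hμν f hf
    conv_lhs => rw [← Measure.withDensity_rnDeriv_eq μ ν hμν]
    refine withDensity_congr_ae ?_
    filter_upwards [hf, Measure.rnDeriv_lt_top μ ν] with x hx hlt
    rw [hx, ENNReal.ofReal_toReal hlt.ne]
  refine ⟨llr μ₁ μ₀, measurable_llr _ _, hdens _ _ hac₁ _ (exp_llr_of_ac' _ _ hac₀),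
    hdens _ _ hac₀ _ (exp_neg_llr hac₁), hint₀.neg.congr hneg, hint₁, ?_, hv₁.symm⟩
  rw [← integral_congr_ae hneg, hv₀]
  simp [integral_neg]

/-- The ratios are at least `1` since the family lies in the class, so a uniform upper bound by the
common asymptotic value suffices. -/
theorem highDimOptimal_of_eventually_le {μ₀ μ₁ : Measure E} [IsProbabilityMeasure μ₀]
    [IsProbabilityMeasure μ₁] {I₀ I₁ : ℝ} (hI₀ : 0 < I₀) (hI₁ : 0 < I₁) {l u : ℕ → ℕ}
    (hlu : ∀ m : ℕ, 1 ≤ m → l m ≤ u m ∧ u m ≤ m) (hu : Tendsto u atTop atTop)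
    (hl : Tendsto (fun m : ℕ => m - l m) atTop atTop)
    (hb : ∀ α ∈ Set.Ioo (0 : ℝ) 1, ∀ β ∈ Set.Ioo (0 : ℝ) 1, ∀ δ > 0, ∀ᶠ m : ℕ in atTop,
      SizeBounds μ₀ μ₁ (alphaM l α m) (betaM u β m)
        (Real.log (u m) / I₀) (Real.log ((m : ℝ) - l m) / I₁) δ)
    {χ : ℝ → ℝ → SeqTest E} (hχ : IsTestFamily μ₀ μ₁ χ)
    (h : ∀ α ∈ Set.Ioo (0 : ℝ) 1, ∀ β ∈ Set.Ioo (0 : ℝ) 1, ∀ δ > (0 : ℝ), ∀ᶠ m : ℕ in atTop,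
      ∀ s ∈ Finset.Icc (l m) (u m),
        expSampleSize (mixLaw μ₀ μ₁ ((s : ℝ) / m)) (χ (alphaM l α m) (betaM u β m)) ≤
          ENNReal.ofReal ((1 + δ) * ((1 - (s : ℝ) / m) * (Real.log (u m) / I₀) +
            (s : ℝ) / m * (Real.log ((m : ℝ) - l m) / I₁)))) :
    HighDimOptimal μ₀ μ₁ l u χ := by
  intro α hα β hβ
  have key : ∀ δ : ℝ, 0 < δ → δ < 1 → ∀ᶠ m : ℕ in atTop, ∀ s ∈ Finset.Icc (l m) (u m),
      1 ≤ expSampleSize (mixLaw μ₀ μ₁ ((s : ℝ) / m)) (χ (alphaM l α m) (betaM u β m)) /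
        optSampleSize μ₀ μ₁ (mixLaw μ₀ μ₁ ((s : ℝ) / m)) (alphaM l α m) (betaM u β m) ∧
      expSampleSize (mixLaw μ₀ μ₁ ((s : ℝ) / m)) (χ (alphaM l α m) (betaM u β m)) /
        optSampleSize μ₀ μ₁ (mixLaw μ₀ μ₁ ((s : ℝ) / m)) (alphaM l α m) (betaM u β m) ≤
          ENNReal.ofReal ((1 + δ) / (1 - δ)) := by
    intro δ hδ hδ1
    filter_upwards [eventually_levels hu hl hα hβ, hb α hα β hβ δ hδ, h α hα β hβ δ hδ,
      eventually_ge_atTop 1] with m ⟨hαm, hβm, hp, hq⟩ hbm hm h1m s hs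
    have hm0 : (0 : ℝ) < m := by exact_mod_cast h1m
    have hsm : s ≤ m := (Finset.mem_Icc.1 hs).2.trans (hlu m h1m).2
    set π : ℝ := (s : ℝ) / m with hπ
    have h0 : 0 ≤ π := by positivity
    have h1 : π ≤ 1 := (div_le_one hm0).2 (by exact_mod_cast hsm)
    have hp' := div_pos hp hI₀
    have hq' := div_pos hq hI₁
    have hG := convexComb_pos h0 h1 hp' hq'
    obtain ⟨hlo, hup⟩ := hbm.optSampleSize_mem hp'.le hq'.le hδ.le hδ1.le h0 h1
    have hne : optSampleSize μ₀ μ₁ (mixLaw μ₀ μ₁ π) (alphaM l α m) (betaM u β m) ≠ 0 :=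
      (lt_of_lt_of_le (ENNReal.ofReal_pos.2 (mul_pos (by linarith) hG)) hlo).ne'
    have hnt : optSampleSize μ₀ μ₁ (mixLaw μ₀ μ₁ π) (alphaM l α m) (betaM u β m) ≠ ∞ :=
      (hup.trans_lt ENNReal.ofReal_lt_top).ne
    constructor
    · rw [ENNReal.le_div_iff_mul_le (Or.inl hne) (Or.inl hnt), one_mul]
      exact iInf₂_le _ (hχ _ hαm _ hβm)
    · rw [ENNReal.div_le_iff hne hnt]
      refine (hm s hs).trans (le_trans (le_of_eq ?_) (mul_le_mul_right hlo _))
      rw [← ENNReal.ofReal_mul (div_nonneg (by linarith) (by linarith)), ← mul_assoc,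
        div_mul_cancel₀ _ (by linarith : (1 - δ) ≠ 0)]
  refine tendsto_order.2 ⟨fun c hc => ?_, fun c hc => ?_⟩
  · filter_upwards [key (1 / 2) (by norm_num) (by norm_num), eventually_ge_atTop 1] with m hm h1m
    -- The range of `s` is nonempty, so the supremum inherits the lower bound `1`.
    have hmem := Finset.left_mem_Icc.2 (hlu m h1m).1
    exact hc.trans_le ((hm _ hmem).1.trans (le_iSup₂ (α := ℝ≥0∞) _ hmem))
  · obtain ⟨d, hd1, hdc⟩ := ENNReal.lt_iff_exists_nnreal_btwn.1 hc
    have hd : (1 : ℝ) < d := by exact_mod_cast hd1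
    have hpos : (0 : ℝ) < d + 1 := by linarith
    -- This `δ` solves `(1 + δ) / (1 - δ) = d`.
    filter_upwards [key ((d - 1) / (d + 1)) (div_pos (by linarith) hpos)
      ((div_lt_one hpos).2 (by linarith))] with m hm
    refine lt_of_le_of_lt (iSup₂_le fun s hs => ((hm s hs).2.trans (le_of_eq ?_))) hdc
    have : (1 + ((d : ℝ) - 1) / (d + 1)) / (1 - (d - 1) / (d + 1)) = d := by
      field_simp
      ring
    rw [this, ENNReal.ofReal_coe_nnreal]

/-- A test family whose expected sample size is asymptotically optimal under `P`, compared with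
the optimal value `p` of the expected sample size. -/
theorem OptimalAlong.eventually_le {μ₀ μ₁ : Measure E} [IsProbabilityMeasure μ₀]
    [IsProbabilityMeasure μ₁] {P : Measure (ℕ → E)} {l u : ℕ → ℕ} {χ : ℝ → ℝ → SeqTest E}
    (h : OptimalAlong μ₀ μ₁ P l u χ) {α β : ℝ} (hα : α ∈ Set.Ioo (0 : ℝ) 1)
    (hβ : β ∈ Set.Ioo (0 : ℝ) 1) {δ : ℝ} (hδ : 0 < δ) {p : ℕ → ℝ}
    (hp : ∀ᶠ m in atTop, optSampleSize μ₀ μ₁ P (alphaM l α m) (betaM u β m) ≤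
      ENNReal.ofReal ((1 + δ) * p m)) :
    ∀ᶠ m in atTop, expSampleSize P (χ (alphaM l α m) (betaM u β m)) ≤
      ENNReal.ofReal ((1 + δ) * ((1 + δ) * p m)) := by
  have h1 : (1 : ℝ≥0∞) < ENNReal.ofReal (1 + δ) := by
    rw [← ENNReal.ofReal_one]
    exact (ENNReal.ofReal_lt_ofReal_iff (by linarith)).2 (by linarith)
  filter_upwards [hp, (h α hα β hβ).eventually_lt_const h1] with m hpm hm
  rw [ENNReal.ofReal_mul (by linarith)]
  refine le_trans ?_ (mul_le_mul_right hpm _)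
  exact (ENNReal.div_le_iff_le_mul (Or.inr ENNReal.ofReal_ne_top)
    (Or.inl (hpm.trans_lt ENNReal.ofReal_lt_top).ne)).1 hm.le

end SignalRecovery

theorem mainTheorem2 {E : Type*} [MeasurableSpace E] (ν : Measure E) [SigmaFinite ν]
    (f₀ f₁ : E → ℝ≥0∞) (hf₀ : Measurable f₀) (hf₁ : Measurable f₁)
    [IsProbabilityMeasure (ν.withDensity f₀)] [IsProbabilityMeasure (ν.withDensity f₁)]
    (I₀ I₁ : ℝ) (hI₀ : 0 < I₀) (hI₁ : 0 < I₁)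
    (hKL₀ : klDiv (ν.withDensity f₀) (ν.withDensity f₁) = ENNReal.ofReal I₀)
    (hKL₁ : klDiv (ν.withDensity f₁) (ν.withDensity f₀) = ENNReal.ofReal I₁)
    (l u : ℕ → ℕ)
    (hlu : ∀ m : ℕ, 1 ≤ m → l m ≤ u m ∧ u m ≤ m ∧ 0 < u m ∧ l m < m)
    (hu : Tendsto u atTop atTop) (hl : Tendsto (fun m : ℕ => m - l m) atTop atTop) :
    (∀ α ∈ Set.Ioo (0 : ℝ) 1, ∀ β ∈ Set.Ioo (0 : ℝ) 1, ∀ ε > (0 : ℝ), ∀ᶠ m : ℕ in atTop,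
      ∀ s ∈ Finset.Icc (l m) (u m),
        optSampleSize (ν.withDensity f₀) (ν.withDensity f₁)
          (mixLaw (ν.withDensity f₀) (ν.withDensity f₁) ((s : ℝ) / m))
          (alphaM l α m) (betaM u β m) ≠ ∞ ∧
        |(optSampleSize (ν.withDensity f₀) (ν.withDensity f₁)
            (mixLaw (ν.withDensity f₀) (ν.withDensity f₁) ((s : ℝ) / m))
            (alphaM l α m) (betaM u β m)).toReal /
          ((1 - (s : ℝ) / m) * (Real.log (u m) / I₀) +
            (s : ℝ) / m * (Real.log ((m : ℝ) - l m) / I₁)) - 1| < ε) ∧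
    (∀ χ : ℝ → ℝ → SeqTest E, IsTestFamily (ν.withDensity f₀) (ν.withDensity f₁) χ →
      OptimalAlong (ν.withDensity f₀) (ν.withDensity f₁) (pathLaw (ν.withDensity f₀)) l u χ →
      OptimalAlong (ν.withDensity f₀) (ν.withDensity f₁) (pathLaw (ν.withDensity f₁)) l u χ →
      HighDimOptimal (ν.withDensity f₀) (ν.withDensity f₁) l u χ) ∧
    (∀ χ : ℝ → ℝ → SeqTest E, IsTestFamily (ν.withDensity f₀) (ν.withDensity f₁) χ →
      OptimalAlong (ν.withDensity f₀) (ν.withDensity f₁) (pathLaw (ν.withDensity f₀)) l u χ →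
      (∀ α ∈ Set.Ioo (0 : ℝ) 1, ∀ β ∈ Set.Ioo (0 : ℝ) 1,
        Tendsto (fun m : ℕ =>
          expSampleSize (pathLaw (ν.withDensity f₁)) (χ (alphaM l α m) (betaM u β m)) /
            ENNReal.ofReal (((m : ℝ) - u m) * Real.log (u m) / u m)) atTop (𝓝 0)) →
      HighDimOptimal (ν.withDensity f₀) (ν.withDensity f₁) l u χ) := by
  obtain ⟨Y, hY, h₁, h₀, hi₀, hi₁, hY₀, hY₁⟩ := exists_logLikelihoodRatio hI₀ hI₁ hKL₀ hKL₁
  set μ₀ := ν.withDensity f₀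
  set μ₁ := ν.withDensity f₁
  have hb : ∀ α ∈ Set.Ioo (0 : ℝ) 1, ∀ β ∈ Set.Ioo (0 : ℝ) 1, ∀ δ > 0, ∀ᶠ m : ℕ in atTop,
      SizeBounds μ₀ μ₁ (alphaM l α m) (betaM u β m)
        (Real.log (u m) / I₀) (Real.log ((m : ℝ) - l m) / I₁) δ := fun α hα β hβ δ hδ =>
    eventually_sizeBounds hY h₁ h₀ hi₀ hi₁ hI₀ hI₁ hY₀ hY₁ hu hl hα hβ hδ
  have hopt : ∀ α ∈ Set.Ioo (0 : ℝ) 1, ∀ β ∈ Set.Ioo (0 : ℝ) 1, ∀ δ > 0, ∀ᶠ m : ℕ in atTop,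
      optSampleSize μ₀ μ₁ (pathLaw μ₀) (alphaM l α m) (betaM u β m) ≤
          ENNReal.ofReal ((1 + δ) * (Real.log (u m) / I₀)) ∧
        optSampleSize μ₀ μ₁ (pathLaw μ₁) (alphaM l α m) (betaM u β m) ≤
          ENNReal.ofReal ((1 + δ) * (Real.log ((m : ℝ) - l m) / I₁)) := by
    intro α hα β hβ δ hδ
    filter_upwards [hb α hα β hβ δ hδ] with m hm
    obtain ⟨τ, hτ, hτ0, hτ1⟩ := hm.ge
    exact ⟨(iInf₂_le τ hτ).trans hτ0, (iInf₂_le τ hτ).trans hτ1⟩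
  have hπ : ∀ m s : ℕ, 1 ≤ m → s ∈ Finset.Icc (l m) (u m) →
      0 ≤ (s : ℝ) / m ∧ (s : ℝ) / m ≤ (u m : ℝ) / m ∧ (s : ℝ) / m ≤ 1 := by
    intro m s hm hs
    have hsu := (Finset.mem_Icc.1 hs).2
    have hm0 : (0 : ℝ) < m := by exact_mod_cast hm
    refine ⟨by positivity, by gcongr, (div_le_one hm0).2 ?_⟩
    exact_mod_cast hsu.trans (hlu m hm).2.1
  have hlu' : ∀ m : ℕ, 1 ≤ m → l m ≤ u m ∧ u m ≤ m := fun m hm =>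
    ⟨(hlu m hm).1, (hlu m hm).2.1⟩
  refine ⟨fun α hα β hβ ε hε => ?_, fun χ hχ hχ₀ hχ₁ => ?_, fun χ hχ hχ₀ hχ₁ => ?_⟩
  -- `ε / 2` makes the final inequality strict; the cap `1` keeps `1 - δ` nonnegative.
  · have hδ : 0 < min (ε / 2) 1 := lt_min (by linarith) one_pos
    filter_upwards [eventually_levels hu hl hα hβ, hb α hα β hβ _ hδ,
      eventually_ge_atTop 1] with m ⟨_, _, hp, hq⟩ hm h1m s hs
    obtain ⟨h0, -, h1⟩ := hπ m s h1m hs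
    have hp' := div_pos hp hI₀
    have hq' := div_pos hq hI₁
    obtain ⟨hlo, hup⟩ := hm.optSampleSize_mem hp'.le hq'.le hδ.le (min_le_right _ _) h0 h1
    have hG := convexComb_pos h0 h1 hp' hq'
    have hnt := (hup.trans_lt ENNReal.ofReal_lt_top).ne
    refine ⟨hnt, ?_⟩
    rw [ENNReal.ofReal_le_iff_le_toReal hnt, ← le_div_iff₀ hG] at hlo
    rw [ENNReal.le_ofReal_iff_toReal_le hnt (mul_nonneg (by linarith) hG.le),
      ← div_le_iff₀ hG] at hup
    have := min_le_left (ε / 2) 1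
    rw [abs_lt]
    constructor <;> linarith
  · refine highDimOptimal_of_eventually_le hI₀ hI₁ hlu' hu hl hb hχ fun α hα β hβ δ hδ => ?_
    -- For `η ≤ 1`, `(1 + η)² ≤ 1 + 3η ≤ 1 + δ`.
    have hη : 0 < min (δ / 3) 1 := lt_min (by linarith) one_pos
    filter_upwards [eventually_levels hu hl hα hβ,
      hχ₀.eventually_le hα hβ hη ((hopt α hα β hβ _ hη).mono fun _ h => h.1),
      hχ₁.eventually_le hα hβ hη ((hopt α hα β hβ _ hη).mono fun _ h => h.2),
      eventually_ge_atTop 1] with m ⟨_, _, hp, hq⟩ hm0 hm1 h1m s hs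
    obtain ⟨h0, -, h1⟩ := hπ m s h1m hs
    have hp' := div_pos hp hI₀
    have hq' := div_pos hq hI₁
    have hG := convexComb_pos h0 h1 hp' hq'
    generalize hηd : min (δ / 3) 1 = η at *
    have hη3 : η ≤ δ / 3 := hηd ▸ min_le_left _ _
    have hη1 : η ≤ 1 := hηd ▸ min_le_right _ _
    rw [expSampleSize_mixLaw]
    refine (add_le_add (mul_le_mul_right hm0 _) (mul_le_mul_right hm1 _)).trans ?_
    rw [ofReal_convexComb h0 h1 (by positivity) (by positivity)]
    refine ENNReal.ofReal_le_ofReal ?_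
    have : (1 + η) * (1 + η) ≤ 1 + δ := by nlinarith
    nlinarith [mul_le_mul_of_nonneg_right this hG.le]
  · refine highDimOptimal_of_eventually_le hI₀ hI₁ hlu' hu hl hb hχ fun α hα β hβ δ hδ => ?_
    -- One more `η` than in (ii) pays for the `P₁` term: `(1 + η)² + η ≤ 1 + 4η`.
    have hη : 0 < min (δ / 4) 1 := lt_min (by linarith) one_pos
    have hc : (0 : ℝ≥0∞) < ENNReal.ofReal (min (δ / 4) 1 / I₀) :=
      ENNReal.ofReal_pos.2 (div_pos hη hI₀)
    filter_upwards [eventually_levels hu hl hα hβ,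
      hχ₀.eventually_le hα hβ hη ((hopt α hα β hβ _ hη).mono fun _ h => h.1),
      (hχ₁ α hα β hβ).eventually_lt_const hc,
      eventually_ge_atTop 1] with m ⟨_, _, hp, hq⟩ hm0 hm1 h1m s hs
    obtain ⟨h0, hsu, h1⟩ := hπ m s h1m hs
    have hp' := div_pos hp hI₀
    have hq' := div_pos hq hI₁
    have hG := convexComb_pos h0 h1 hp' hq'
    generalize hηd : min (δ / 4) 1 = η at *
    have hη4 : η ≤ δ / 4 := hηd ▸ min_le_left _ _
    have hη1 : η ≤ 1 := hηd ▸ min_le_right _ _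
    have hm_pos : (0 : ℝ) < m := by exact_mod_cast h1m
    have hu_pos : (0 : ℝ) < u m := by exact_mod_cast (hlu m h1m).2.2.1
    have hum : (u m : ℝ) ≤ m := by exact_mod_cast (hlu m h1m).2.1
    set R : ℝ := ((m : ℝ) - u m) * Real.log (u m) / u m with hR
    have hR0 : 0 ≤ R := div_nonneg (mul_nonneg (by linarith) hp.le) hu_pos.le
    have hm1' : expSampleSize (pathLaw μ₁) (χ (alphaM l α m) (betaM u β m)) ≤
        ENNReal.ofReal (η / I₀ * R) := by
      rw [ENNReal.ofReal_mul (by positivity)]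
      exact (ENNReal.div_le_iff_le_mul (Or.inr ENNReal.ofReal_ne_top)
        (Or.inl ENNReal.ofReal_ne_top)).1 hm1.le
    rw [expSampleSize_mixLaw]
    refine (add_le_add (mul_le_mul_right hm0 _) (mul_le_mul_right hm1' _)).trans ?_
    rw [ofReal_convexComb h0 h1 (by positivity) (by positivity)]
    refine ENNReal.ofReal_le_ofReal ?_
    set π : ℝ := (s : ℝ) / m
    -- The growth condition enters here: `R` is scaled so that `(u m / m) * R = (1 - u m / m) * log
    -- (u m)`, and `π ≤ u m / m` is used twice.
    have hπR : π * R ≤ (1 - π) * Real.log (u m) := by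
      calc π * R ≤ (u m : ℝ) / m * R := by gcongr
        _ = (1 - (u m : ℝ) / m) * Real.log (u m) := by
          rw [hR]
          field_simp
        _ ≤ (1 - π) * Real.log (u m) := by gcongr
    have e1 : π * (η / I₀ * R) ≤ η * ((1 - π) * (Real.log (u m) / I₀)) := by
      calc π * (η / I₀ * R) = η / I₀ * (π * R) := by ring
        _ ≤ η / I₀ * ((1 - π) * Real.log (u m)) := by gcongr
        _ = _ := by ring
    have e2 : (1 + η) * (1 + η) + η ≤ 1 + δ := by nlinarith
    have e3 : 0 ≤ (1 - π) * (Real.log (u m) / I₀) :=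
      mul_nonneg (by linarith) hp'.le
    have e4 : 0 ≤ (1 + δ) * (π * (Real.log ((m : ℝ) - l m) / I₁)) := by positivity
    nlinarith [mul_le_mul_of_nonneg_right e2 e3]
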